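/- All graphs are finite, simple and undirected. For a graph $G$ with adjacency matrix $A(G)$ and diagonal degree matrix $D(G)$, and for $\alpha\in[0,1)$, let $A_\alpha(G)=\alpha D(G)+(1-\alpha)A(G)$, and let $\rho_{A_\alpha}(G)$ be its spectral radius, the largest absolute value of an eigenvalue of $A_\alpha(G)$. Let $C_n$ ($n\ge 3$) be the cycle on $n$ vertices, and let $W_n$ ($n\ge 6$) be the double snake of order $n$: the tree obtained from a path $v_0v_1\cdots v_{n-5}$ by attaching two pendant vertices to $v_0$ and two pendant vertices to $v_{n-5}$. An internal path of $G$ is a walk $v_0v_1\cdots v_k$ with $k\ge 1$ that uses no edge twice, such that $v_1,\dots,v_k$ are pairwise distinct, $d(v_0)>2$, $d(v_k)>2$, and $d(v_i)=2$ whenever $0<i<k$ (the case $v_0=v_k$ is allowed). Let $G$ be a connected graph, let $uv$ be an edge of $G$, let $G_{uv}$ be the graph obtained from $G$ by subdividing the edge $uv$ (that is, by deleting $uv$ and adding a new vertex adjacent exactly to $u$ and $v$), and let $\alpha\in[0,1)$. Then: (i) $\rho_{A_\alpha}(C_n)=2$ for every $n\ge 3$, and $\rho_{A_0}(W_n)=2$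 for every $n\ge 6$. (ii) If $G$ is not isomorphic to a cycle $C_n$ and $uv$ does not belong to any internal path of $G$, then $\rho_{A_\alpha}(G_{uv})>\rho_{A_\alpha}(G)$. (iii) If it is not the case that both $\alpha=0$ and $G$ is isomorphic to some $W_n$, and if $uv$ belongs to an internal path of $G$, then $\rho_{A_\alpha}(G_{uv})<\rho_{A_\alpha}(G)$. -/

import Mathlib

open scoped ENNReal

namespace AlphaInternal

/-- Nikiforov's matrix `A_α(G) = α D(G) + (1 - α) A(G)`. -/
noncomputable def alphaMatrix {V : Type*} [Fintype V] [DecidableEq V]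
    (G : SimpleGraph V) [DecidableRel G.Adj] (α : ℝ) : Matrix V V ℝ :=
  α • G.degMatrix ℝ + (1 - α) • G.adjMatrix ℝ

open scoped Classical in
/-- The `A_α`-spectral radius of `G`: the largest absolute value of an eigenvalue of `A_α(G)`.
Since `A_α(G)` is a real symmetric matrix, its spectrum is real. The value lies in `[0, ∞)`. -/
noncomputable def rho {V : Type*} [Fintype V] [DecidableEq V]
    (G : SimpleGraph V) (α : ℝ) : ℝ≥0∞ :=
  spectralRadius ℝ (alphaMatrix G α)

/-- The double snake `W_n` of order `n ≥ 6`: the path `0, 1, …, n - 3` together with a pendant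
vertex `n - 2` attached to `1` and a pendant vertex `n - 1` attached to `n - 4`. -/
def doubleSnake (n : ℕ) : SimpleGraph (Fin n) :=
  SimpleGraph.fromRel fun i j : Fin n =>
    (i.val + 1 = j.val ∧ j.val + 2 < n) ∨
    (i.val = 1 ∧ j.val + 2 = n) ∨
    (i.val + 4 = n ∧ j.val + 1 = n)

/-- The graph `G_{uv}` obtained from `G` by subdividing the edge `uv`: the edge `uv` is deleted, and
a new vertex `none` is joined to `u` and to `v`. -/
def subdivide {V : Type*} (G : SimpleGraph V) (u v : V) : SimpleGraph (Option V) where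
  Adj
    | some a, some b => G.Adj a b ∧ s(a, b) ≠ s(u, v)
    | some a, none => a = u ∨ a = v
    | none, some b => b = u ∨ b = v
    | none, none => False
  symm := ⟨by
    rintro (_ | a) (_ | b) h
    · exact h
    · exact h
    · exact h
    · exact ⟨h.1.symm, by rw [Sym2.eq_swap]; exact h.2⟩⟩
  loopless := ⟨by
    rintro (_ | a) h
    · exact h
    · exact G.loopless.irrefl a h.1⟩

open scoped Classical in
/-- An internal path `v₀ v₁ … v_k` of `G`: a walk of length `k ≥ 1` that uses no edge twice, in
which `v₁, …, v_k` are pairwise distinct, `d(v₀) > 2`, `d(v_k) > 2`, and `d(v_i) = 2` for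
`0 < i < k`. The ends may coincide (type I, a cycle) or differ (type II, a path).
That no edge is used twice only rules out the back-and-forth walks `v₀ v₁ v₀`. -/
structure IsInternalPath {V : Type*} [Fintype V] (G : SimpleGraph V) {a b : V}
    (w : G.Walk a b) : Prop where
  one_le_length : 1 ≤ w.length
  isTrail : w.IsTrail
  tail_nodup : w.support.tail.Nodup
  two_lt_degree_start : 2 < G.degree a
  two_lt_degree_end : 2 < G.degree b
  degree_interior : ∀ i, 0 < i → i < w.length → G.degree (w.getVert i) = 2

/-- The edge `uv` belongs to some internal path of `G`. -/
def OnInternalPath {V : Type*} [Fintype V] (G : SimpleGraph V) (u v : V) : Prop :=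
  ∃ (a b : V) (w : G.Walk a b), IsInternalPath G w ∧ s(u, v) ∈ w.edges

/-- `G` is (isomorphic to) a cycle `C_n`, `n ≥ 3`. -/
def IsCycleGraph {V : Type*} (G : SimpleGraph V) : Prop :=
  ∃ n : ℕ, 3 ≤ n ∧ Nonempty (G ≃g SimpleGraph.cycleGraph n)

/-- `G` is (isomorphic to) a double snake `W_n`, `n ≥ 6`. -/
def IsDoubleSnake {V : Type*} (G : SimpleGraph V) : Prop :=
  ∃ n : ℕ, 6 ≤ n ∧ Nonempty (G ≃g doubleSnake n)

end AlphaInternal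

/-! Everything rests on positive eigenvectors. A connected graph has one, and its eigenvalue is
`rho` (`PerronPair.rho_eq`). Write A for `alphaOp`. Since A is symmetric, pairing the positive
eigenvector with a nonnegative test vector y turns A y ≥ s y, strict somewhere, into s < rho
(`PerronPair.lt_of_sub`), and the reversed inequalities into rho < s (`PerronPair.lt_of_super`).
Each strict comparison of G with its subdivision uses a test vector on the subdivided graph, built
from the Perron vector x of G.

Subdividing either edge at a vertex of degree two gives isomorphic graphs. Along a chain of such
vertices the subdivided edge may therefore be chosen freely (`IsChain.rho_subdivide`).

Edges on no internal path: if G is not a cycle, the edge lies on a path with interior degrees two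
that ends in a pendant vertex (`exists_pendant_thread`). After a shift to the pendant edge, the
subdivision is G with one more pendant vertex, and its spectral radius is larger.

Edges on an internal path: shift to an edge pq where p minimises x along the path. The new vertex
receives x p, the value at p is lowered if necessary, and all other values stay
(`rho_subdivide_lt_rho`). This needs rho > 2. An explicit vector supported on the path and its
neighbours gives rho ≥ 2, and equality forces α = 0 and a double snake (`IsBranchChain.two_lt`). -/

namespace AlphaInternal

/-! ### Perron theory of the operator and comparison by test vectors -/

section Perron

variable {V : Type*} [Fintype V]

open scoped Classical in
/-- The action of `A_α(G)` on a vector, written as a sum over adjacent pairs. -/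
noncomputable def alphaOp (G : SimpleGraph V) (α : ℝ) (x : V → ℝ) (i : V) : ℝ :=
  ∑ j, if G.Adj i j then α * x i + (1 - α) * x j else 0

open scoped Classical in
theorem alphaMatrix_mulVec [DecidableEq V] (G : SimpleGraph V) (α : ℝ) (x : V → ℝ) :
    (alphaMatrix G α).mulVec x = alphaOp G α x := by
  funext i
  rw [alphaMatrix, Matrix.add_mulVec, Matrix.smul_mulVec, Matrix.smul_mulVec, Pi.add_apply,
    Pi.smul_apply, Pi.smul_apply, SimpleGraph.degMatrix_mulVec_apply,
    SimpleGraph.adjMatrix_mulVec_apply, alphaOp, ← Finset.sum_filter, Finset.sum_add_distrib,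
    ← SimpleGraph.neighborFinset_eq_filter, Finset.sum_const, SimpleGraph.card_neighborFinset_eq_degree,
    ← Finset.mul_sum]
  simp only [smul_eq_mul, nsmul_eq_mul]
  ring

theorem sum_mul_alphaOp_comm (G : SimpleGraph V) (α : ℝ) (x y : V → ℝ) :
    ∑ i, x i * alphaOp G α y i = ∑ i, y i * alphaOp G α x i := by
  classical
  have key : ∀ x y : V → ℝ, ∑ i, x i * alphaOp G α y i =
      (∑ i, ∑ j, if G.Adj i j then α * (x i * y i) else 0) +
        ∑ i, ∑ j, if G.Adj i j then (1 - α) * (x i * y j) else 0 := by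
    intro x y
    rw [← Finset.sum_add_distrib]
    refine Finset.sum_congr rfl fun i _ => ?_
    rw [alphaOp, Finset.mul_sum, ← Finset.sum_add_distrib]
    refine Finset.sum_congr rfl fun j _ => ?_
    split_ifs <;> ring
  rw [key x y, key y x]
  congr 1
  · simp only [mul_comm (x _)]
  · rw [Finset.sum_comm]
    simp only [G.adj_comm, mul_comm (x _)]

theorem alphaOp_mono {G : SimpleGraph V} {α : ℝ} (h0 : 0 ≤ α) (h1 : α < 1) {x y : V → ℝ}
    (h : ∀ i, x i ≤ y i) (i : V) : alphaOp G α x i ≤ alphaOp G α y i := by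
  classical
  refine Finset.sum_le_sum fun j _ => ?_
  split_ifs
  · have := mul_le_mul_of_nonneg_left (h i) h0
    have := mul_le_mul_of_nonneg_left (h j) (sub_nonneg.2 h1.le)
    linarith
  · exact le_rfl

theorem alphaOp_nonneg {G : SimpleGraph V} {α : ℝ} (h0 : 0 ≤ α) (h1 : α < 1) {x : V → ℝ}
    (h : ∀ i, 0 ≤ x i) (i : V) : 0 ≤ alphaOp G α x i := by
  have := alphaOp_mono (G := G) h0 h1 h i
  simpa [alphaOp] using this

theorem abs_alphaOp_le {G : SimpleGraph V} {α : ℝ} (h0 : 0 ≤ α) (h1 : α < 1) (x : V → ℝ) (i : V) :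
    |alphaOp G α x i| ≤ alphaOp G α (fun j => |x j|) i := by
  classical
  refine (Finset.abs_sum_le_sum_abs _ _).trans (Finset.sum_le_sum fun j _ => ?_)
  split_ifs
  · refine (abs_add_le _ _).trans ?_
    rw [abs_mul, abs_mul, abs_of_nonneg h0, abs_of_nonneg (sub_nonneg.2 h1.le)]
  · simp

/-- `x` is a positive eigenvector of `A_α(G)` for the eigenvalue `r`. -/
structure PerronPair (G : SimpleGraph V) (α r : ℝ) (x : V → ℝ) : Prop where
  pos : ∀ i, 0 < x i
  eig : ∀ i, alphaOp G α x i = r * x i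

theorem PerronPair.nonneg [Nonempty V] {G : SimpleGraph V} {α r : ℝ} {x : V → ℝ}
    (h0 : 0 ≤ α) (h1 : α < 1) (h : PerronPair G α r x) : 0 ≤ r := by
  obtain ⟨i⟩ := ‹Nonempty V›
  have := alphaOp_nonneg (G := G) h0 h1 (fun i => (h.pos i).le) i
  rw [h.eig] at this
  exact nonneg_of_mul_nonneg_left this (h.pos i)

theorem mem_spectrum_iff [DecidableEq V] (G : SimpleGraph V) (α μ : ℝ) :
    open scoped Classical in
    μ ∈ spectrum ℝ (alphaMatrix G α) ↔
      ∃ z : V → ℝ, z ≠ 0 ∧ ∀ i, alphaOp G α z i = μ * z i := by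
  classical
  rw [← Matrix.spectrum_toLin', ← Module.End.hasEigenvalue_iff_mem_spectrum]
  constructor
  · intro h
    obtain ⟨z, hz⟩ := h.exists_hasEigenvector
    refine ⟨z, hz.2, fun i => ?_⟩
    have := hz.apply_eq_smul
    rw [Matrix.toLin'_apply, alphaMatrix_mulVec] at this
    simpa using congrFun this i
  · rintro ⟨z, hz0, hz⟩
    refine Module.End.hasEigenvalue_of_hasEigenvector (x := z) ⟨?_, hz0⟩
    rw [Module.End.mem_eigenspace_iff, Matrix.toLin'_apply, alphaMatrix_mulVec]
    funext i
    simpa using hz i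

/-- If z has eigenvalue μ, the entrywise bound |A z| ≤ A |z| paired with the positive eigenvector
gives |μ| ≤ r, and r is itself an eigenvalue. -/
theorem PerronPair.rho_eq [Nonempty V] [DecidableEq V] {G : SimpleGraph V} {α r : ℝ} {x : V → ℝ}
    (h0 : 0 ≤ α) (h1 : α < 1) (h : PerronPair G α r x) : rho G α = ENNReal.ofReal r := by
  classical
  have hr := h.nonneg h0 h1
  unfold rho spectralRadius
  apply le_antisymm
  · refine iSup₂_le fun μ hμ => ?_
    rw [mem_spectrum_iff] at hμ
    obtain ⟨z, hz0, hz⟩ := hμ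
    have key : |μ| * ∑ i, x i * |z i| ≤ r * ∑ i, x i * |z i| := by
      calc |μ| * ∑ i, x i * |z i| = ∑ i, x i * |alphaOp G α z i| := by
            rw [Finset.mul_sum]
            refine Finset.sum_congr rfl fun i _ => ?_
            rw [hz, abs_mul]; ring
        _ ≤ ∑ i, x i * alphaOp G α (fun j => |z j|) i :=
            Finset.sum_le_sum fun i _ =>
              mul_le_mul_of_nonneg_left (abs_alphaOp_le h0 h1 z i) (h.pos i).le
        _ = r * ∑ i, x i * |z i| := by
            rw [sum_mul_alphaOp_comm, Finset.mul_sum]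
            refine Finset.sum_congr rfl fun i _ => ?_
            rw [h.eig]; ring
    have hpos : 0 < ∑ i, x i * |z i| := by
      obtain ⟨i, hi⟩ := Function.ne_iff.1 hz0
      refine Finset.sum_pos' (fun j _ => mul_nonneg (h.pos j).le (abs_nonneg _))
        ⟨i, Finset.mem_univ _, mul_pos (h.pos i) (abs_pos.2 hi)⟩
    have := le_of_mul_le_mul_right key hpos
    rw [← enorm_eq_nnnorm, ← ofReal_norm]
    exact ENNReal.ofReal_le_ofReal (by simpa using this)
  · have hmem : r ∈ spectrum ℝ (alphaMatrix G α) := by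
      rw [mem_spectrum_iff]
      refine ⟨x, ?_, h.eig⟩
      obtain ⟨i⟩ := ‹Nonempty V›
      exact Function.ne_iff.2 ⟨i, (h.pos i).ne'⟩
    refine le_trans (le_of_eq ?_) (le_iSup₂ (f := fun k _ => ((‖k‖₊ : NNReal) : ℝ≥0∞)) r hmem)
    rw [← enorm_eq_nnnorm, ← ofReal_norm, Real.norm_of_nonneg hr]

/-- The Rayleigh quotient attains its maximum on the unit sphere, and passing to absolute values
does not decrease it. The nonnegative vector so obtained is again a maximiser, hence an eigenvector.
-/
theorem exists_nonneg_eigenvector [Nonempty V] (G : SimpleGraph V) {α : ℝ}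
    (h0 : 0 ≤ α) (h1 : α < 1) :
    ∃ (r : ℝ) (x : V → ℝ), (∀ i, 0 ≤ x i) ∧ x ≠ 0 ∧ ∀ i, alphaOp G α x i = r * x i := by
  classical
  let M := alphaMatrix G α
  let T : EuclideanSpace ℝ V →L[ℝ] EuclideanSpace ℝ V := Matrix.toEuclideanCLM (𝕜 := ℝ) M
  have hTi : ∀ z i, T z i = alphaOp G α z i := by
    intro z i
    have : (T z).ofLp = M.mulVec z.ofLp := by simp [T]
    rw [this, alphaMatrix_mulVec]
  have hT : IsSelfAdjoint T := by
    rw [ContinuousLinearMap.isSelfAdjoint_iff_isSymmetric]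
    intro x y
    change inner ℝ (T x) y = inner ℝ x (T y)
    simp only [PiLp.inner_apply, hTi, RCLike.inner_apply, conj_trivial]
    rw [sum_mul_alphaOp_comm]
    simp only [mul_comm]
  have hin : ∀ z, T.reApplyInnerSelf z = ∑ i, z i * alphaOp G α z i := by
    intro z
    rw [ContinuousLinearMap.reApplyInnerSelf_apply]
    simp [PiLp.inner_apply, hTi]
  have hne : (Metric.sphere (0 : EuclideanSpace ℝ V) 1).Nonempty :=
    NormedSpace.sphere_nonempty.2 zero_le_one
  obtain ⟨z, hz, hmax⟩ := (isCompact_sphere (0 : EuclideanSpace ℝ V) 1).exists_isMaxOn hne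
    T.reApplyInnerSelf_continuous.continuousOn
  let w : EuclideanSpace ℝ V := WithLp.toLp 2 fun i => |z i|
  have hw : ‖w‖ = 1 := by
    rw [← mem_sphere_zero_iff_norm.1 hz, EuclideanSpace.norm_eq, EuclideanSpace.norm_eq]
    simp [w]
  have hw0 : w ≠ 0 := by
    intro h; rw [h] at hw; simp at hw
  have hle : T.reApplyInnerSelf z ≤ T.reApplyInnerSelf w := by
    rw [hin, hin]
    refine Finset.sum_le_sum fun i _ => ?_
    refine (le_abs_self _).trans ?_
    rw [abs_mul]
    exact mul_le_mul_of_nonneg_left (abs_alphaOp_le h0 h1 _ i) (abs_nonneg _)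
  have hmaxw : IsMaxOn T.reApplyInnerSelf (Metric.sphere (0 : EuclideanSpace ℝ V) ‖w‖) w := by
    rw [hw]
    exact fun y hy => (hmax hy).trans hle
  obtain ⟨r, hr⟩ : ∃ r : ℝ, T w = r • w :=
    ⟨_, (hT.hasEigenvector_of_isMaxOn hw0 hmaxw).apply_eq_smul⟩
  refine ⟨r, fun i => |z i|, fun i => abs_nonneg _, fun h => hw0 ?_, fun i => ?_⟩
  · ext i; exact congrFun h i
  · exact (hTi w i).symm.trans (congrFun (congrArg WithLp.ofLp hr) i)

theorem alphaOp_pos_of_adj {G : SimpleGraph V} {α : ℝ} (h0 : 0 ≤ α) (h1 : α < 1) {x : V → ℝ}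
    (hx : ∀ i, 0 ≤ x i) {i j : V} (hij : G.Adj i j) (hj : 0 < x j) : 0 < alphaOp G α x i := by
  classical
  refine Finset.sum_pos' (fun k _ => ?_) ⟨j, Finset.mem_univ _, ?_⟩
  · split_ifs
    · exact add_nonneg (mul_nonneg h0 (hx i)) (mul_nonneg (sub_nonneg.2 h1.le) (hx k))
    · exact le_rfl
  · rw [if_pos hij]
    exact add_pos_of_nonneg_of_pos (mul_nonneg h0 (hx i)) (mul_pos (sub_pos.2 h1) hj)

/-- A zero entry with a positive neighbour would contradict the eigenvalue equation, so positivity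
spreads along walks. -/
theorem pos_of_nonneg_eigenvector {G : SimpleGraph V} (hG : G.Connected) {α r : ℝ}
    (h0 : 0 ≤ α) (h1 : α < 1) {x : V → ℝ} (hx : ∀ i, 0 ≤ x i) (hx0 : x ≠ 0)
    (he : ∀ i, alphaOp G α x i = r * x i) (i : V) : 0 < x i := by
  obtain ⟨j, hj⟩ := Function.ne_iff.1 hx0
  replace hj : 0 < x j := lt_of_le_of_ne (hx j) (Ne.symm hj)
  obtain ⟨w⟩ := hG.preconnected i j
  induction w with
  | nil => exact hj
  | cons h p ih =>
    refine lt_of_le_of_ne (hx _) fun h' => ?_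
    have := alphaOp_pos_of_adj h0 h1 hx h (ih hj)
    rw [he, ← h', mul_zero] at this
    exact lt_irrefl _ this

theorem exists_perronPair {G : SimpleGraph V} (hG : G.Connected) {α : ℝ}
    (h0 : 0 ≤ α) (h1 : α < 1) : ∃ r x, PerronPair G α r x := by
  have := hG.nonempty
  obtain ⟨r, x, hx, hx0, he⟩ := exists_nonneg_eigenvector G h0 h1
  exact ⟨r, x, pos_of_nonneg_eigenvector hG h0 h1 hx hx0 he, he⟩

theorem PerronPair.mul_sum {G : SimpleGraph V} {α r : ℝ} {x : V → ℝ}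
    (h : PerronPair G α r x) (y : V → ℝ) :
    ∑ i, x i * alphaOp G α y i = ∑ i, x i * (r * y i) := by
  rw [sum_mul_alphaOp_comm]
  refine Finset.sum_congr rfl fun i _ => ?_
  rw [h.eig]; ring

/-- A nonnegative vector with `A y ≥ s y`, strictly somewhere, bounds the Perron root from below. -/
theorem PerronPair.lt_of_sub {G : SimpleGraph V} {α r s : ℝ} {x y : V → ℝ}
    (h : PerronPair G α r x) (hy : ∀ i, 0 ≤ y i)
    (hs : ∀ i, s * y i ≤ alphaOp G α y i) (hs' : ∃ i, s * y i < alphaOp G α y i) : s < r := by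
  by_contra! hlt
  have h1 := h.mul_sum y
  obtain ⟨i, hi⟩ := hs'
  have h2 : ∑ i, x i * (s * y i) < ∑ i, x i * alphaOp G α y i :=
    Finset.sum_lt_sum (fun i _ => mul_le_mul_of_nonneg_left (hs i) (h.pos i).le)
      ⟨i, Finset.mem_univ _, mul_lt_mul_of_pos_left hi (h.pos i)⟩
  have h3 : ∑ i, x i * (r * y i) ≤ ∑ i, x i * (s * y i) :=
    Finset.sum_le_sum fun i _ =>
      mul_le_mul_of_nonneg_left (mul_le_mul_of_nonneg_right hlt (hy i)) (h.pos i).le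
  linarith

theorem PerronPair.lt_of_super {G : SimpleGraph V} {α r s : ℝ} {x y : V → ℝ}
    (h : PerronPair G α r x) (hy : ∀ i, 0 ≤ y i)
    (hs : ∀ i, alphaOp G α y i ≤ s * y i) (hs' : ∃ i, alphaOp G α y i < s * y i) : r < s := by
  by_contra! hlt
  have h1 := h.mul_sum y
  obtain ⟨i, hi⟩ := hs'
  have h2 : ∑ i, x i * alphaOp G α y i < ∑ i, x i * (s * y i) :=
    Finset.sum_lt_sum (fun i _ => mul_le_mul_of_nonneg_left (hs i) (h.pos i).le)
      ⟨i, Finset.mem_univ _, mul_lt_mul_of_pos_left hi (h.pos i)⟩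
  have h3 : ∑ i, x i * (s * y i) ≤ ∑ i, x i * (r * y i) :=
    Finset.sum_le_sum fun i _ =>
      mul_le_mul_of_nonneg_left (mul_le_mul_of_nonneg_right hlt (hy i)) (h.pos i).le
  linarith

theorem PerronPair.of_iso {W : Type*} [Fintype W] {G : SimpleGraph V} {H : SimpleGraph W}
    (e : G ≃g H) {α r : ℝ} {x : V → ℝ} (h : PerronPair G α r x) :
    PerronPair H α r (fun w => x (e.symm w)) := by
  classical
  refine ⟨fun w => h.pos _, fun w => ?_⟩
  rw [← h.eig, alphaOp, alphaOp]
  refine Fintype.sum_equiv e.symm.toEquiv _ _ fun j => ?_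
  have : G.Adj (e.symm w) (e.symm j) ↔ H.Adj w j := e.symm.map_adj_iff
  simp [this]

theorem rho_congr {W : Type*} [Fintype W] [DecidableEq V] [DecidableEq W] {G : SimpleGraph V}
    {H : SimpleGraph W} (hG : G.Connected) (e : G ≃g H) {α : ℝ} (h0 : 0 ≤ α) (h1 : α < 1) :
    rho G α = rho H α := by
  have := hG.nonempty
  have : Nonempty W := this.map e
  obtain ⟨r, x, h⟩ := exists_perronPair hG h0 h1
  rw [h.rho_eq h0 h1, (h.of_iso e).rho_eq h0 h1]

theorem alphaOp_eq (G : SimpleGraph V) (α : ℝ) (x : V → ℝ) (i : V) :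
    open scoped Classical in
    alphaOp G α x i = ∑ j ∈ G.neighborFinset i, (α * x i + (1 - α) * x j) := by
  classical
  rw [alphaOp, ← Finset.sum_filter, SimpleGraph.neighborFinset_eq_filter]

theorem alphaOp_eq' (G : SimpleGraph V) (α : ℝ) (x : V → ℝ) (i : V) :
    open scoped Classical in
    alphaOp G α x i = α * G.degree i * x i + (1 - α) * ∑ j ∈ G.neighborFinset i, x j := by
  classical
  rw [alphaOp_eq, Finset.sum_add_distrib, Finset.sum_const, ← Finset.mul_sum,
    SimpleGraph.card_neighborFinset_eq_degree]
  simp only [nsmul_eq_mul]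
  ring

end Perron
-- Subdividing an edge: shifting, pendant edges, and the contracting test vector
section Subdivision

variable {V : Type*}

theorem subdivide_comm (G : SimpleGraph V) (u v : V) : subdivide G u v = subdivide G v u := by
  ext a b
  rcases a with _ | a <;> rcases b with _ | b <;> simp [subdivide, or_comm, Sym2.eq_swap (a := u)]

theorem subdivide_connected {G : SimpleGraph V} (hG : G.Connected) (u v : V) :
    (subdivide G u v).Connected := by
  have hu : (subdivide G u v).Adj (some u) none := Or.inl rfl
  have hv : (subdivide G u v).Adj (some v) none := Or.inr rfl
  have key : ∀ a b, G.Adj a b → (subdivide G u v).Reachable (some a) (some b) := by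
    intro a b hab
    by_cases h : s(a, b) = s(u, v)
    · rcases Sym2.eq_iff.1 h with ⟨rfl, rfl⟩ | ⟨rfl, rfl⟩
      · exact hu.reachable.trans hv.symm.reachable
      · exact hv.reachable.trans hu.symm.reachable
    · exact SimpleGraph.Adj.reachable (show (subdivide G u v).Adj _ _ from ⟨hab, h⟩)
  have hsome : ∀ a b, (subdivide G u v).Reachable (some a) (some b) := by
    intro a b
    obtain ⟨w⟩ := hG.preconnected a b
    induction w with
    | nil => exact SimpleGraph.Reachable.rfl
    | cons h _ ih => exact (key _ _ h).trans ih
  have hnone : ∀ a, (subdivide G u v).Reachable (some a) none := fun a =>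
    (hsome a u).trans hu.reachable
  refine (SimpleGraph.connected_iff _).2 ⟨?_, ⟨none⟩⟩
  rintro (_ | a) (_ | b)
  · exact SimpleGraph.Reachable.rfl
  · exact (hnone b).symm
  · exact hnone a
  · exact hsome a b

/-- Subdividing either of the two edges at a vertex of degree two gives isomorphic graphs. -/
def subdivideShift [DecidableEq V] {G : SimpleGraph V} {u v w : V} (huv : G.Adj u v)
    (hvw : G.Adj v w) (huw : u ≠ w) (hv : ∀ z, G.Adj v z → z = u ∨ z = w) :
    subdivide G u v ≃g subdivide G v w where
  toEquiv := Equiv.swap none (some v)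
  map_rel_iff' := by
    have h1 := huv.ne
    have h2 := hvw.ne
    have h3 := huv.symm
    have hsn : ∀ a, a ≠ v → Equiv.swap none (some v) (some a) = some a := fun a ha =>
      Equiv.swap_apply_of_ne_of_ne (by simp) (by simpa using ha)
    have hvb : ∀ b, b ≠ v → (b = u ∨ b = v ↔ G.Adj v b ∧ s(v, b) ≠ s(v, w)) := by
      intro b hb
      rw [Ne, Sym2.congr_right]
      constructor
      · rintro (rfl | rfl)
        · exact ⟨h3, huw⟩
        · exact absurd rfl hb
      · rintro ⟨h, h'⟩
        exact Or.inl ((hv b h).resolve_right h')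
    have hvb' : ∀ b, b ≠ v → (G.Adj v b ∧ s(v, b) ≠ s(u, v) ↔ b = v ∨ b = w) := by
      intro b hb
      rw [Sym2.eq_swap (a := u), Ne, Sym2.congr_right]
      constructor
      · rintro ⟨h, h'⟩
        exact Or.inr ((hv b h).resolve_left h')
      · rintro (rfl | rfl)
        · exact absurd rfl hb
        · exact ⟨hvw, huw.symm⟩
    have hns : ∀ b, (subdivide G v w).Adj (Equiv.swap none (some v) none)
        (Equiv.swap none (some v) (some b)) ↔ (subdivide G u v).Adj none (some b) := by
      intro b
      by_cases hb : b = v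
      · subst hb
        rw [Equiv.swap_apply_left, Equiv.swap_apply_right]
        exact iff_of_true (Or.inl rfl) (Or.inr rfl)
      · rw [Equiv.swap_apply_left, hsn b hb]
        exact (hvb b hb).symm
    have hvs : ∀ b, b ≠ v → ((subdivide G v w).Adj (Equiv.swap none (some v) (some v))
        (Equiv.swap none (some v) (some b)) ↔ (subdivide G u v).Adj (some v) (some b)) := by
      intro b hb
      rw [Equiv.swap_apply_right, hsn b hb]
      exact (hvb' b hb).symm
    rintro (_ | a) (_ | b)
    · simp
    · exact hns b
    · rw [SimpleGraph.adj_comm, SimpleGraph.adj_comm _ (some a)]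
      exact hns a
    · by_cases ha : a = v <;> by_cases hb : b = v
      · subst ha; subst hb; simp
      · subst ha; exact hvs b hb
      · subst hb
        rw [SimpleGraph.adj_comm, SimpleGraph.adj_comm _ (some a)]
        exact hvs a ha
      · rw [hsn a ha, hsn b hb]
        refine and_congr_right fun _ => ?_
        rw [Ne, Ne, Sym2.eq_iff, Sym2.eq_iff]
        tauto

variable [Fintype V]

theorem rho_subdivide_shift [DecidableEq V] {G : SimpleGraph V} (hG : G.Connected) {α : ℝ}
    (h0 : 0 ≤ α) (h1 : α < 1) {u v w : V} (huv : G.Adj u v)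
    (hvw : G.Adj v w) (huw : u ≠ w) (hv : ∀ z, G.Adj v z → z = u ∨ z = w) :
    rho (subdivide G u v) α = rho (subdivide G v w) α :=
  rho_congr (subdivide_connected hG u v) (subdivideShift huv hvw huw hv) h0 h1

theorem alphaOp_subdivide_none {G : SimpleGraph V} {u v : V} (h : u ≠ v) (α : ℝ)
    (y : Option V → ℝ) : alphaOp (subdivide G u v) α y none =
      2 * α * y none + (1 - α) * (y (some u) + y (some v)) := by
  classical
  rw [alphaOp, Fintype.sum_option, ← Finset.sum_filter]
  have : Finset.univ.filter (fun j => (subdivide G u v).Adj none (some j)) = {u, v} := by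
    ext j; simp [subdivide]
  rw [this, Finset.sum_pair h]
  simp [subdivide]
  ring

open scoped Classical in
-- G and its subdivision share the graph with uv deleted. Isolating that common part here and in
-- `alphaOp_eq_add_deleteEdges` lets the two operators be compared term by term.
theorem alphaOp_subdivide_some {G : SimpleGraph V} (u v : V) (α : ℝ)
    (y : Option V → ℝ) (a : V) : alphaOp (subdivide G u v) α y (some a) =
      (if a = u ∨ a = v then α * y (some a) + (1 - α) * y none else 0) +
      alphaOp (G.deleteEdges {s(u, v)}) α (fun b => y (some b)) a := by
  rw [alphaOp, Fintype.sum_option, alphaOp]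
  simp [subdivide, SimpleGraph.deleteEdges_adj]

theorem alphaOp_eq_add_deleteEdges {G : SimpleGraph V} {u v : V} (h : G.Adj u v) (α : ℝ)
    (x : V → ℝ) : alphaOp G α x u = α * x u + (1 - α) * x v +
      alphaOp (G.deleteEdges {s(u, v)}) α x u := by
  classical
  have hnot : ¬ (G.deleteEdges {s(u, v)}).Adj u v := by simp [SimpleGraph.deleteEdges_adj]
  have h2 : alphaOp (G.deleteEdges {s(u, v)}) α x u = _ :=
    (Finset.add_sum_erase _ _ (Finset.mem_univ v)).symm
  rw [h2, if_neg hnot, zero_add, alphaOp, ← Finset.add_sum_erase _ _ (Finset.mem_univ v), if_pos h]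
  congr 1
  refine Finset.sum_congr rfl fun j hj => ?_
  have : s(u, j) ≠ s(u, v) := by
    rw [Ne, Sym2.congr_right]; exact (Finset.mem_erase.1 hj).1
  simp [SimpleGraph.deleteEdges_adj, this]

theorem alphaOp_deleteEdges_of_ne {G : SimpleGraph V} {u v a : V} (hu : a ≠ u) (hv : a ≠ v) (α : ℝ)
    (x : V → ℝ) : alphaOp (G.deleteEdges {s(u, v)}) α x a = alphaOp G α x a := by
  classical
  refine Finset.sum_congr rfl fun j _ => ?_
  have : s(a, j) ≠ s(u, v) := by
    rw [Ne, Sym2.eq_iff]; tauto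
  simp [SimpleGraph.deleteEdges_adj, this]

theorem alphaOp_congr {G : SimpleGraph V} {α : ℝ} {x y : V → ℝ} {i : V} (hi : x i = y i)
    (h : ∀ j, G.Adj i j → x j = y j) : alphaOp G α x i = alphaOp G α y i := by
  classical
  refine Finset.sum_congr rfl fun j _ => ?_
  split_ifs with hj
  · rw [hi, h j hj]
  · rfl

theorem alphaOp_lt {G : SimpleGraph V} {α : ℝ} (h0 : 0 ≤ α) (h1 : α < 1) {x y : V → ℝ}
    (h : ∀ i, x i ≤ y i) {i j : V} (hij : G.Adj i j) (hj : x j < y j) :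
    alphaOp G α x i < alphaOp G α y i := by
  classical
  refine Finset.sum_lt_sum (fun k _ => ?_) ⟨j, Finset.mem_univ _, ?_⟩
  · split_ifs
    · have := mul_le_mul_of_nonneg_left (h i) h0
      have := mul_le_mul_of_nonneg_left (h k) (sub_nonneg.2 h1.le)
      linarith
    · exact le_rfl
  · rw [if_pos hij, if_pos hij]
    have := mul_le_mul_of_nonneg_left (h i) h0
    have := mul_lt_mul_of_pos_left hj (sub_pos.2 h1)
    linarith

/-- Subdividing a pendant edge increases the spectral radius. -/
theorem rho_lt_rho_subdivide_of_pendant [DecidableEq V] {G : SimpleGraph V} (hG : G.Connected)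
    {α : ℝ} (h0 : 0 ≤ α) (h1 : α < 1) {u v : V} (huv : G.Adj u v)
    (hv : ∀ z, G.Adj v z → z = u) : rho G α < rho (subdivide G u v) α := by
  have := hG.nonempty
  obtain ⟨r, x, hx⟩ := exists_perronPair hG h0 h1
  obtain ⟨r', z, hz⟩ := exists_perronPair (subdivide_connected hG u v) h0 h1
  rw [hx.rho_eq h0 h1, hz.rho_eq h0 h1]
  have hr := hx.nonneg h0 h1
  suffices r < r' from (ENNReal.ofReal_lt_ofReal_iff (hr.trans_lt this)).2 this
  have hne := huv.ne
  have hiso : ∀ a, ¬ (G.deleteEdges {s(u, v)}).Adj a v := by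
    intro a h
    rw [SimpleGraph.deleteEdges_adj] at h
    exact h.2 (by rw [hv a h.1.symm]; rfl)
  -- The new vertex plays the part of the old pendant vertex v, so G reappears inside the
  -- subdivision; v becomes an extra vertex of value 0, where the inequality is strict.
  let y : Option V → ℝ := fun o => o.elim (x v) (fun a => if a = v then 0 else x a)
  have hy0 : ∀ o, 0 ≤ y o := by
    rintro (_ | a)
    · exact (hx.pos v).le
    · simp only [y, Option.elim]
      split_ifs
      · exact le_rfl
      · exact (hx.pos a).le
  have hyn : y none = x v := rfl
  have hyv : y (some v) = 0 := by simp [y]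
  have hya : ∀ a, a ≠ v → y (some a) = x a := fun a ha => by simp [y, ha]
  have hop : ∀ a, a ≠ v → alphaOp (G.deleteEdges {s(u, v)}) α (fun b => y (some b)) a =
      alphaOp (G.deleteEdges {s(u, v)}) α x a := fun a ha =>
    alphaOp_congr (hya a ha) fun j hj => hya j fun h => hiso a (h ▸ hj)
  have hstrict : r * y (some v) < alphaOp (subdivide G u v) α y (some v) := by
    rw [hyv, mul_zero, alphaOp_subdivide_some, if_pos (Or.inr rfl), hyv, hyn]
    have := alphaOp_nonneg (G := G.deleteEdges {s(u, v)}) h0 h1 (fun a => hy0 (some a)) v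
    have := mul_pos (sub_pos.2 h1) (hx.pos v)
    linarith
  refine hz.lt_of_sub hy0 ?_ ⟨some v, hstrict⟩
  rintro (_ | a)
  · rw [alphaOp_subdivide_none hne, hyn, hyv, hya u hne, ← hx.eig,
      alphaOp_eq_add_deleteEdges huv.symm, Sym2.eq_swap]
    have : alphaOp (G.deleteEdges {s(u, v)}) α x v = 0 :=
      Finset.sum_eq_zero fun j _ => if_neg fun h => hiso j h.symm
    rw [this]
    have := mul_nonneg h0 (hx.pos v).le
    linarith
  · by_cases hav : a = v
    · rw [hav]; exact hstrict.le
    · rw [alphaOp_subdivide_some, hop a hav, hya a hav, hyn, ← hx.eig]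
      by_cases hau : a = u
      · rw [hau, if_pos (Or.inl rfl), alphaOp_eq_add_deleteEdges huv]
      · rw [if_neg (by tauto), alphaOp_deleteEdges_of_ne hau hav, zero_add]

/-- This is the inequality needed at p in `rho_subdivide_lt_rho` when its value drops to S + e X,
with X = x p, S the sum of x over the other neighbours, t = (r - 2α) / (1 - α) and e = α (d - 1) /
(1 - α). Multiplying the difference of the two sides by t + e and using `h3` leaves at least X (t -
2 - 3e + (t² - e²) e), which is nonnegative because t ≥ 2 and e < 1 give t² - e² ≥ 3. -/
theorem contraction_inequality {X S t e : ℝ} (hX : 0 < X) (hS : 0 ≤ S) (ht : 2 ≤ t) (he : 0 ≤ e)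
    (h1 : X + S ≤ (t - e) * X) (h2 : S + e * X < X) (h3 : 2 * X ≤ (t + e) * S) :
    S + X ≤ (t - e) * (S + e * X) := by
  have he1 : e < 1 := by
    by_contra! h
    nlinarith
  have h4 : 0 ≤ t - e - 1 := by
    by_contra! h
    nlinarith
  have hte : 0 < t + e := by linarith
  have h5 : 0 ≤ t - 2 - 3 * e + (t ^ 2 - e ^ 2) * e := by
    have : 3 ≤ t ^ 2 - e ^ 2 := by nlinarith
    nlinarith
  have h6 := mul_le_mul_of_nonneg_left h3 h4
  have h7 := mul_nonneg hX.le h5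
  by_contra! h
  have h8 := mul_lt_mul_of_pos_left h hte
  nlinarith

/-- If the Perron root exceeds two, subdividing `pq` decreases it as soon as `x p ≤ x q` and `p`
has either two further neighbours or a further neighbour of weight at least `x p`. -/
theorem rho_subdivide_lt_rho [DecidableEq V] {G : SimpleGraph V} (hG : G.Connected)
    {α : ℝ} (h0 : 0 ≤ α) (h1 : α < 1) {p q : V} (hpq : G.Adj p q) {r : ℝ} {x : V → ℝ}
    (hx : PerronPair G α r x) (hr : 2 < r) (hle : x p ≤ x q)
    {a : V} (hpa : G.Adj p a) (haq : a ≠ q)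
    (hd : x p ≤ x a ∨ ∃ b, G.Adj p b ∧ b ≠ q ∧ b ≠ a) :
    rho (subdivide G p q) α < rho G α := by
  classical
  have := hG.nonempty
  obtain ⟨r', z, hz⟩ := exists_perronPair (subdivide_connected hG p q) h0 h1
  rw [hx.rho_eq h0 h1, hz.rho_eq h0 h1]
  suffices r' < r from (ENNReal.ofReal_lt_ofReal_iff (by linarith)).2 this
  have hne := hpq.ne
  obtain ⟨H, hH⟩ : ∃ H, H = G.deleteEdges {s(p, q)} := ⟨_, rfl⟩
  have hHadj : ∀ j, G.Adj p j → j ≠ q → H.Adj p j := by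
    intro j hj hjq
    rw [hH, SimpleGraph.deleteEdges_adj, Set.mem_singleton_iff, Sym2.congr_right]
    exact ⟨hj, hjq⟩
  have haH := hHadj a hpa haq
  have hd1 : 1 ≤ H.degree p := (H.degree_pos_iff_exists_adj p).2 ⟨a, haH⟩
  replace hd : 2 ≤ H.degree p ∨ x p ≤ ∑ j ∈ H.neighborFinset p, x j := by
    rcases hd with hd | ⟨b, hpb, hbq, hba⟩
    · refine Or.inr (hd.trans (Finset.single_le_sum (f := x) (fun j _ => (hx.pos j).le) ?_))
      rwa [SimpleGraph.mem_neighborFinset]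
    · left
      rw [← SimpleGraph.card_neighborFinset_eq_degree]
      refine Finset.one_lt_card.2 ⟨a, ?_, b, ?_, hba.symm⟩ <;> rw [SimpleGraph.mem_neighborFinset]
      exacts [haH, hHadj b hpb hbq]
  set d : ℝ := (H.degree p : ℝ) with hdd
  set S := ∑ j ∈ H.neighborFinset p, x j with hS
  have hb : 0 < 1 - α := sub_pos.2 h1
  have hX := hx.pos p
  have hd1' : 1 ≤ d := by rw [hdd]; exact_mod_cast hd1
  have hS0 : 0 ≤ S := Finset.sum_nonneg fun j _ => (hx.pos j).le
  have heig : r * x p = α * x p + (1 - α) * x q + (α * d * x p + (1 - α) * S) := by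
    rw [← hx.eig, alphaOp_eq_add_deleteEdges hpq, ← hH, alphaOp_eq']
  set e := α * (d - 1) / (1 - α) with he
  have hbe : (1 - α) * e = α * (d - 1) := by rw [he]; field_simp
  have he0 : 0 ≤ e := div_nonneg (mul_nonneg h0 (by linarith)) hb.le
  -- At the new vertex, with value x p, the inequality A y ≤ r y says exactly c ≤ S + e * x p. The
  -- value c at p is the largest one allowed by this and by c ≤ x p.
  obtain ⟨c, hcX, hc0, hcs, hcases⟩ : ∃ c, c ≤ x p ∧ 0 ≤ c ∧ c ≤ S + e * x p ∧
      (c = x p ∨ (c < x p ∧ c = S + e * x p)) := by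
    rcases le_or_gt (x p) (S + e * x p) with h | h
    · exact ⟨x p, le_rfl, hX.le, h, Or.inl rfl⟩
    · exact ⟨S + e * x p, h.le, add_nonneg hS0 (mul_nonneg he0 hX.le), le_rfl, Or.inr ⟨h, rfl⟩⟩
  let y : Option V → ℝ := fun o => o.elim (x p) (fun a => if a = p then c else x a)
  have hyn : y none = x p := rfl
  have hyp : y (some p) = c := by simp [y]
  have hya : ∀ a, a ≠ p → y (some a) = x a := fun a ha => by simp [y, ha]
  have hyx : ∀ a, y (some a) ≤ x a := by
    intro a
    by_cases h : a = p
    · rw [h, hyp]; exact hcX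
    · rw [hya a h]
  have hy0 : ∀ o, 0 ≤ y o := by
    rintro (_ | a)
    · exact hX.le
    · by_cases h : a = p
      · rw [h, hyp]; exact hc0
      · rw [hya a h]; exact (hx.pos a).le
  have hHp : alphaOp H α (fun b => y (some b)) p = α * d * c + (1 - α) * S := by
    rw [alphaOp_eq', hyp]
    refine congrArg (fun s => _ + (1 - α) * s) (Finset.sum_congr rfl fun j hj => hya j ?_)
    rintro rfl
    simp at hj
  have hopn : alphaOp (subdivide G p q) α y none = 2 * α * x p + (1 - α) * (c + x q) := by
    rw [alphaOp_subdivide_none hne, hyn, hyp, hya q hne.symm]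
  have hopp : alphaOp (subdivide G p q) α y (some p) =
      α * c + (1 - α) * x p + (α * d * c + (1 - α) * S) := by
    rw [alphaOp_subdivide_some, if_pos (Or.inl rfl), hyp, hyn, ← hH, hHp]
  have hopa : ∀ a, a ≠ p → alphaOp (subdivide G p q) α y (some a) =
      r * x a - alphaOp H α x a + alphaOp H α (fun b => y (some b)) a := by
    intro a ha
    rw [alphaOp_subdivide_some, hya a ha, hyn, ← hx.eig, ← hH]
    congr 1
    by_cases haq : a = q
    · rw [haq, if_pos (Or.inr rfl), alphaOp_eq_add_deleteEdges hpq.symm, hH,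
        Sym2.eq_swap (a := q)]
      ring
    · rw [if_neg (by tauto), hH, alphaOp_deleteEdges_of_ne ha haq]; ring
  have hn : alphaOp (subdivide G p q) α y none ≤ r * y none := by
    rw [hopn, hyn, heig]
    have := mul_le_mul_of_nonneg_left hcs hb.le
    have : (1 - α) * (S + e * x p) = (1 - α) * S + α * (d - 1) * x p := by
      rw [mul_add, ← mul_assoc, hbe]
    linarith
  have hp : alphaOp (subdivide G p q) α y (some p) ≤ r * y (some p) := by
    rw [hopp, hyp]
    rcases hcases with rfl | ⟨hlt, hc⟩
    · rw [heig]
      have := mul_le_mul_of_nonneg_left hle hb.le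
      linarith
    · have hSX : S < x p := by
        have := mul_nonneg he0 hX.le
        linarith
      -- A further neighbour of weight at least x p would give x p ≤ S, so in this case p has two
      -- further neighbours.
      have hd2 : 2 ≤ d := by rw [hdd]; exact_mod_cast hd.resolve_right (not_le.2 hSX)
      -- Each neighbour j of p in H is adjacent to p in G, so (r - α) x j ≥ (1 - α) x p; these are
      -- summed over j.
      have hsum : d * ((1 - α) * x p) ≤ (r - α) * S := by
        rw [hS, Finset.mul_sum, hdd, ← SimpleGraph.card_neighborFinset_eq_degree, ← nsmul_eq_mul]
        refine Finset.card_nsmul_le_sum _ _ _ fun j hj => ?_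
        have hjp : G.Adj j p := by
          rw [SimpleGraph.mem_neighborFinset, hH, SimpleGraph.deleteEdges_adj] at hj
          exact hj.1.symm
        have h2 := hx.eig j
        rw [alphaOp_eq_add_deleteEdges hjp] at h2
        have := alphaOp_nonneg (G := G.deleteEdges {s(j, p)}) h0 h1 (fun a => (hx.pos a).le) j
        linarith
      have ht : 2 ≤ (r - 2 * α) / (1 - α) := by
        rw [le_div_iff₀ hb]; linarith
      have hte : ((r - 2 * α) / (1 - α) - e) * (1 - α) = r - α - α * d := by
        rw [he, sub_mul, div_mul_cancel₀ _ hb.ne', div_mul_cancel₀ _ hb.ne']; ring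
      have := contraction_inequality hX hS0 ht he0 ?_ (hc ▸ hlt) ?_
      · have h5 := mul_le_mul_of_nonneg_left this hb.le
        rw [← mul_assoc, mul_comm (1 - α) (_ - e), hte, ← hc] at h5
        linarith
      · refine le_of_mul_le_mul_left ?_ hb
        rw [← mul_assoc, mul_comm (1 - α) (_ - e), hte]
        have := mul_le_mul_of_nonneg_left hle hb.le
        linarith
      · refine le_of_mul_le_mul_left ?_ hb
        have h6 : (1 - α) * (((r - 2 * α) / (1 - α) + e) * S) = (r - 2 * α + α * (d - 1)) * S := by
          rw [← mul_assoc, mul_add, hbe, mul_div_cancel₀ _ hb.ne']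
        rw [h6]
        have h7 := mul_le_mul_of_nonneg_right hd2 (mul_nonneg hb.le hX.le)
        have h8 : 0 ≤ α * (d - 2) * S := mul_nonneg (mul_nonneg h0 (by linarith)) hS0
        linarith
  have ha : ∀ o, alphaOp (subdivide G p q) α y o ≤ r * y o := by
    rintro (_ | a)
    · exact hn
    · by_cases hap : a = p
      · rw [hap]; exact hp
      · rw [hopa a hap, hya a hap]
        have := alphaOp_mono (G := H) h0 h1 hyx a
        linarith
  refine hz.lt_of_super hy0 ha ?_
  -- Strictness: for c = x p it occurs at p if x p < x q, and otherwise at the new vertex, where the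
  -- two sides are 2 x p and r x p. For c < x p it occurs at any neighbour of p other than q.
  rcases hcases with rfl | ⟨hlt, -⟩
  · rcases hle.lt_or_eq with hlt | heq
    · refine ⟨some p, ?_⟩
      rw [hopp, hyp, heig]
      have := mul_lt_mul_of_pos_left hlt hb
      linarith
    · refine ⟨none, ?_⟩
      rw [hopn, hyn, ← heq]
      have := mul_lt_mul_of_pos_right hr hX
      linarith
  · obtain ⟨j, hj⟩ := Finset.card_pos.1 (show 0 < (H.neighborFinset p).card by
      rw [SimpleGraph.card_neighborFinset_eq_degree]; exact hd1)
    rw [SimpleGraph.mem_neighborFinset] at hj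
    refine ⟨some j, ?_⟩
    rw [hopa j hj.ne', hya j hj.ne']
    have := alphaOp_lt h0 h1 hyx hj.symm (by rw [hyp]; exact hlt)
    linarith

end Subdivision
-- Cycles and double snakes: spectral radius two and rigidity
section Extremal

theorem perronPair_cycleGraph {n : ℕ} (hn : 3 ≤ n) (α : ℝ) :
    PerronPair (SimpleGraph.cycleGraph n) α 2 (fun _ => 1) := by
  classical
  obtain ⟨m, rfl⟩ := Nat.exists_eq_add_of_le' hn
  refine ⟨fun _ => one_pos, fun i => ?_⟩
  obtain ⟨H, hH⟩ : ∃ H, H = SimpleGraph.cycleGraph (m + 3) := ⟨_, rfl⟩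
  rw [← hH]
  have h : H.degree i = 2 := by
    subst hH
    convert SimpleGraph.cycleGraph_degree_three_le (n := m) (v := i)
  rw [alphaOp_eq', Finset.sum_const, SimpleGraph.card_neighborFinset_eq_degree, h]
  simp only [nsmul_eq_mul]
  push_cast
  ring

theorem rho_cycleGraph {n : ℕ} (hn : 3 ≤ n) {α : ℝ} (h0 : 0 ≤ α) (h1 : α < 1) :
    rho (SimpleGraph.cycleGraph n) α = 2 := by
  have : Nonempty (Fin n) := ⟨⟨0, by omega⟩⟩
  rw [(perronPair_cycleGraph hn α).rho_eq h0 h1]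
  simp

/-- The Perron vector of the double snake: `1` on the spine and `1 / 2` on the pendant vertices. -/
noncomputable def snakeVec (n : ℕ) (i : Fin n) : ℝ :=
  if 1 ≤ i.val ∧ i.val + 4 ≤ n then 1 else 1 / 2

theorem doubleSnake_adj {n : ℕ} {i j : Fin n} : (doubleSnake n).Adj i j ↔ i.val ≠ j.val ∧
    (((i.val + 1 = j.val ∧ j.val + 2 < n) ∨ (i.val = 1 ∧ j.val + 2 = n) ∨
      (i.val + 4 = n ∧ j.val + 1 = n)) ∨
     ((j.val + 1 = i.val ∧ i.val + 2 < n) ∨ (j.val = 1 ∧ i.val + 2 = n) ∨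
      (j.val + 4 = n ∧ i.val + 1 = n))) := by
  rw [doubleSnake, SimpleGraph.fromRel_adj, Ne, Fin.ext_iff]

theorem perronPair_doubleSnake {n : ℕ} (hn : 6 ≤ n) :
    PerronPair (doubleSnake n) 0 2 (snakeVec n) := by
  classical
  refine ⟨fun i => by unfold snakeVec; split_ifs <;> norm_num, fun i => ?_⟩
  have key : ∀ s : Finset (Fin n), (∀ j, j ∈ s ↔ (doubleSnake n).Adj i j) →
      alphaOp (doubleSnake n) 0 (snakeVec n) i = ∑ j ∈ s, snakeVec n j := by
    intro s hs
    rw [alphaOp, ← Finset.sum_filter]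
    refine Finset.sum_congr ?_ fun j _ => by ring
    ext j; simp [hs]
  have one : ∀ (j : ℕ) (hj : j < n), 1 ≤ j → j + 4 ≤ n → snakeVec n ⟨j, hj⟩ = 1 :=
    fun j hj h h' => if_pos ⟨h, h'⟩
  have half : ∀ (j : ℕ) (hj : j < n), (j = 0 ∨ n < j + 4) → snakeVec n ⟨j, hj⟩ = 1 / 2 :=
    fun j hj h => if_neg (by simp only; omega)
  obtain ⟨i, hi⟩ := i
  have hcases : (i = 0 ∨ i + 2 = n) ∨ (i + 3 = n ∨ i + 1 = n) ∨ i = 1 ∨ i + 4 = n ∨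
      (1 < i ∧ i + 4 < n) := by omega
  rcases hcases with h | h | h | h | h
  · rw [key {⟨1, by omega⟩} (fun j => by
      rw [Finset.mem_singleton, Fin.ext_iff, doubleSnake_adj]; simp only; omega),
      Finset.sum_singleton, one 1 _ (by omega) (by omega), half i _ (by omega)]
    norm_num
  · rw [key {⟨n - 4, by omega⟩} (fun j => by
      rw [Finset.mem_singleton, Fin.ext_iff, doubleSnake_adj]; simp only; omega),
      Finset.sum_singleton, one (n - 4) _ (by omega) (by omega), half i _ (by omega)]
    norm_num
  · rw [key {⟨0, by omega⟩, ⟨2, by omega⟩, ⟨n - 2, by omega⟩} (fun j => by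
      simp only [Finset.mem_singleton, Finset.mem_insert, Fin.ext_iff]
      rw [doubleSnake_adj]; simp only; omega),
      Finset.sum_insert (by
        simp [Fin.ext_iff]; omega),
      Finset.sum_insert (by
        simp [Fin.ext_iff]; omega), Finset.sum_singleton,
      half 0 _ (by omega), one 2 _ (by omega) (by omega), half (n - 2) _ (by omega),
      one i _ (by omega) (by omega)]
    norm_num
  · rw [key {⟨n - 1, by omega⟩, ⟨n - 5, by omega⟩, ⟨n - 3, by omega⟩} (fun j => by
      simp only [Finset.mem_singleton, Finset.mem_insert, Fin.ext_iff]
      rw [doubleSnake_adj]; simp only; omega),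
      Finset.sum_insert (by
        simp [Fin.ext_iff]; omega),
      Finset.sum_insert (by
        simp [Fin.ext_iff]; omega), Finset.sum_singleton,
      half (n - 1) _ (by omega), one (n - 5) _ (by omega) (by omega), half (n - 3) _ (by omega),
      one i _ (by omega) (by omega)]
    norm_num
  · rw [key {⟨i - 1, by omega⟩, ⟨i + 1, by omega⟩} (fun j => by
      simp only [Finset.mem_singleton, Finset.mem_insert, Fin.ext_iff]
      rw [doubleSnake_adj]; simp only; omega),
      Finset.sum_insert (by
        simp [Fin.ext_iff]), Finset.sum_singleton,
      one (i - 1) _ (by omega) (by omega), one (i + 1) _ (by omega) (by omega),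
      one i _ (by omega) (by omega)]
    norm_num

theorem rho_doubleSnake {n : ℕ} (hn : 6 ≤ n) : rho (doubleSnake n) 0 = 2 := by
  have : Nonempty (Fin n) := ⟨⟨0, by omega⟩⟩
  rw [(perronPair_doubleSnake hn).rho_eq le_rfl one_pos]
  simp

/-- A bijective homomorphism that matches positive eigenvectors for the same eigenvalue reflects
adjacency. -/
theorem adj_of_perronPair {V W : Type*} [Fintype V] [Fintype W] {G : SimpleGraph V}
    {H : SimpleGraph W} {α r : ℝ} (h0 : 0 ≤ α) (h1 : α < 1) {x : V → ℝ} {y : W → ℝ}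
    (hx : PerronPair G α r x) (hy : PerronPair H α r y) (f : V ≃ W)
    (hf : ∀ i j, G.Adj i j → H.Adj (f i) (f j)) (hxy : ∀ i, y (f i) = x i) {i j : V}
    (hij : H.Adj (f i) (f j)) : G.Adj i j := by
  classical
  by_contra hn
  have e1 := hx.eig i
  have e2 := hy.eig (f i)
  rw [hxy, ← e1, alphaOp, alphaOp, ← Equiv.sum_comp f] at e2
  refine ne_of_gt ?_ e2
  simp only [hxy]
  have hpos : ∀ k, 0 < α * x i + (1 - α) * x k := fun k =>
    add_pos_of_nonneg_of_pos (mul_nonneg h0 (hx.pos i).le) (mul_pos (sub_pos.2 h1) (hx.pos k))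
  -- All terms are positive, so an extra edge at f i would make the eigenvalue equation there fail.
  refine Finset.sum_lt_sum (fun k _ => ?_) ⟨j, Finset.mem_univ _, ?_⟩
  · by_cases hk : G.Adj i k
    · rw [if_pos hk, if_pos (hf _ _ hk)]
    · rw [if_neg hk]
      split_ifs
      exacts [(hpos k).le, le_rfl]
  · rw [if_neg hn, if_pos hij]
    exact hpos j

end Extremal

/-! ### Chains of vertices of degree two -/

section Chain

variable {V : Type*}

/-- Vertices `v 0, …, v k` traversed without backtracking, the interior ones of degree two. -/
structure IsChain (G : SimpleGraph V) (v : ℕ → V) (k : ℕ) : Prop where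
  adj : ∀ i, i < k → G.Adj (v i) (v (i + 1))
  ne : ∀ i, i + 1 < k → v i ≠ v (i + 2)
  nbr : ∀ i, i + 1 < k → ∀ z, G.Adj (v (i + 1)) z → z = v i ∨ z = v (i + 2)

/-- Two distinct neighbours of `a` other than its neighbour `q`. -/
def HasBranch (G : SimpleGraph V) (a : V) : Prop :=
  ∀ q, G.Adj a q → ∃ b c, G.Adj a b ∧ G.Adj a c ∧ b ≠ q ∧ c ≠ q ∧ b ≠ c

/-- A chain with branching end vertices, without repetitions except possibly of the end vertices. -/
structure IsBranchChain (G : SimpleGraph V) (v : ℕ → V) (k : ℕ) : Prop extends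
    IsChain G v k where
  one_le : 1 ≤ k
  inj : ∀ i j, 1 ≤ i → i ≤ k → 1 ≤ j → j ≤ k → v i = v j → i = j
  branch_start : HasBranch G (v 0)
  branch_end : HasBranch G (v k)

theorem exists_getVert_of_mem_edges {G : SimpleGraph V} {a b : V} {w : G.Walk a b} {e : Sym2 V}
    (h : e ∈ w.edges) : ∃ i < w.length, e = s(w.getVert i, w.getVert (i + 1)) := by
  obtain ⟨i, hi, rfl⟩ := List.mem_iff_getElem.1 h
  have l : w.edges.length = w.length := w.length_edges
  refine ⟨i, by omega, ?_⟩
  simp only [SimpleGraph.Walk.edges, List.getElem_map]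
  rw [SimpleGraph.Walk.darts_getElem_eq_getVert]
  rfl

theorem subdivide_congr {G : SimpleGraph V} {u v a b : V} (h : s(u, v) = s(a, b)) :
    subdivide G u v = subdivide G a b := by
  rcases Sym2.eq_iff.1 h with ⟨rfl, rfl⟩ | ⟨rfl, rfl⟩
  · rfl
  · exact subdivide_comm _ _ _

variable [Fintype V]

open scoped Classical in
theorem hasBranch_of_two_lt_degree {G : SimpleGraph V} {a : V} (h : 2 < G.degree a) :
    HasBranch G a := by
  intro q hq
  have h2 : 1 < ((G.neighborFinset a).erase q).card := by
    rw [Finset.card_erase_of_mem (by rwa [SimpleGraph.mem_neighborFinset]),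
      SimpleGraph.card_neighborFinset_eq_degree]
    omega
  obtain ⟨b, hb, c, hc, hbc⟩ := Finset.one_lt_card.1 h2
  simp only [Finset.mem_erase, SimpleGraph.mem_neighborFinset] at hb hc
  exact ⟨b, c, hb.2, hc.2, hb.1, hc.1, hbc⟩

open scoped Classical in
theorem eq_or_eq_of_degree_eq_two {G : SimpleGraph V} {a b c : V} (h : G.degree a = 2)
    (hb : G.Adj a b) (hc : G.Adj a c) (hbc : b ≠ c) (z : V) (hz : G.Adj a z) : z = b ∨ z = c := by
  by_contra! hn
  have : ({z, b, c} : Finset V) ⊆ G.neighborFinset a := by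
    intro t ht
    simp only [Finset.mem_insert, Finset.mem_singleton] at ht
    rw [SimpleGraph.mem_neighborFinset]
    rcases ht with rfl | rfl | rfl <;> assumption
  have := Finset.card_le_card this
  rw [SimpleGraph.card_neighborFinset_eq_degree, h, Finset.card_eq_three.2
    ⟨z, b, c, hn.1, hn.2, hbc, rfl⟩] at this
  omega

theorem IsInternalPath.isBranchChain {G : SimpleGraph V} {a b : V} {w : G.Walk a b}
    (h : IsInternalPath G w) : IsBranchChain G w.getVert w.length := by
  classical
  have hadj : ∀ i, i < w.length → G.Adj (w.getVert i) (w.getVert (i + 1)) :=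
    fun i hi => w.adj_getVert_succ hi
  have hed : ∀ i (hi : i < w.edges.length), w.edges[i] = s(w.getVert i, w.getVert (i + 1)) := by
    intro i hi
    simp only [SimpleGraph.Walk.edges, List.getElem_map]
    rw [SimpleGraph.Walk.darts_getElem_eq_getVert]
    rfl
  have hne : ∀ i, i + 1 < w.length → w.getVert i ≠ w.getVert (i + 2) := by
    intro i hi he
    have hn := h.isTrail.edges_nodup
    have l : w.edges.length = w.length := w.length_edges
    have h1 := hed i (by omega)
    have h2 := hed (i + 1) (by omega)
    have := (List.Nodup.getElem_inj_iff hn (i := i) (j := i + 1) (hi := by omega)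
      (hj := by omega)).1
      (h1.trans (by rw [he, Sym2.eq_swap, h2]))
    omega
  have htail : ∀ i, i < w.length → ∃ h : i < w.support.tail.length,
      w.support.tail[i] = w.getVert (i + 1) := by
    intro i hi
    have hl : i < w.support.tail.length := by simp; omega
    refine ⟨hl, ?_⟩
    rw [List.getElem_tail, SimpleGraph.Walk.support_getElem_eq_getVert]
  refine ⟨⟨hadj, hne, fun i hi => ?_⟩, h.one_le_length, ?_, ?_, ?_⟩
  · exact eq_or_eq_of_degree_eq_two (h.degree_interior (i + 1) (by omega) hi)
      (hadj i (by omega)).symm (hadj (i + 1) hi) (hne i hi)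
  · intro i j hi hik hj hjk he
    obtain ⟨i, rfl⟩ := Nat.exists_eq_add_of_le' hi
    obtain ⟨j, rfl⟩ := Nat.exists_eq_add_of_le' hj
    obtain ⟨li, ei⟩ := htail i hik
    obtain ⟨lj, ej⟩ := htail j hjk
    rw [(List.Nodup.getElem_inj_iff h.tail_nodup).1 (ei.trans (he.trans ej.symm))]
  · rw [SimpleGraph.Walk.getVert_zero]
    exact hasBranch_of_two_lt_degree h.two_lt_degree_start
  · rw [SimpleGraph.Walk.getVert_length]
    exact hasBranch_of_two_lt_degree h.two_lt_degree_end

/-- Each interior vertex allows the subdivided edge to pass to the adjacent one, so every edge can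
be moved to the first. -/
theorem IsChain.rho_subdivide [DecidableEq V] {G : SimpleGraph V} {v : ℕ → V} {k : ℕ}
    (h : IsChain G v k) (hG : G.Connected) {α : ℝ} (h0 : 0 ≤ α) (h1 : α < 1) {i j : ℕ}
    (hi : i < k) (hj : j < k) :
    rho (subdivide G (v i) (v (i + 1))) α = rho (subdivide G (v j) (v (j + 1))) α := by
  have key : ∀ i, i < k → rho (subdivide G (v i) (v (i + 1))) α =
      rho (subdivide G (v 0) (v (0 + 1))) α := by
    intro i
    induction i with
    | zero => exact fun _ => rfl
    | succ i ih =>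
      intro hi
      rw [← ih (by omega)]
      exact (rho_subdivide_shift hG h0 h1 (h.adj i (by omega)) (h.adj (i + 1) hi) (h.ne i hi)
        (h.nbr i hi)).symm
  rw [key i hi, key j hj]

theorem sum_le_alphaOp {G : SimpleGraph V} {α : ℝ} (h0 : 0 ≤ α) (h1 : α < 1) {y : V → ℝ}
    (hy : ∀ i, 0 ≤ y i) {i : V} (s : Finset V) (hs : ∀ j ∈ s, G.Adj i j) :
    ∑ j ∈ s, (α * y i + (1 - α) * y j) ≤ alphaOp G α y i := by
  classical
  rw [alphaOp_eq]
  refine Finset.sum_le_sum_of_subset_of_nonneg (fun j hj => ?_) fun j _ _ => ?_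
  · rw [SimpleGraph.mem_neighborFinset]; exact hs j hj
  · exact add_nonneg (mul_nonneg h0 (hy i)) (mul_nonneg (sub_nonneg.2 h1.le) (hy j))

/-- In a chain with branching ends, an edge of the chain can be chosen to which
`rho_subdivide_lt_rho` applies. -/
theorem IsBranchChain.rho_subdivide_lt [DecidableEq V] {G : SimpleGraph V} {v : ℕ → V} {k : ℕ}
    (h : IsBranchChain G v k) (hG : G.Connected) {α : ℝ} (h0 : 0 ≤ α) (h1 : α < 1) {r : ℝ}
    {x : V → ℝ} (hx : PerronPair G α r x) (hr : 2 < r) {i : ℕ} (hi : i < k) :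
    rho (subdivide G (v i) (v (i + 1))) α < rho G α := by
  -- The vertex of least weight serves as p. At an interior position its other chain neighbour is at
  -- least as heavy; at an end, branching supplies two further neighbours.
  obtain ⟨m, hm, hmin⟩ := (Finset.range (k + 1)).exists_min_image (fun i => x (v i)) ⟨0, by simp⟩
  simp only [Finset.mem_range, Nat.lt_succ_iff] at hm hmin
  have hk := h.one_le
  rcases Nat.eq_zero_or_pos m with rfl | hm0
  · rw [h.toIsChain.rho_subdivide hG h0 h1 hi (j := 0) hk]
    obtain ⟨b, c, hb, hc, hbq, hcq, hbc⟩ := h.branch_start _ (h.adj 0 hk)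
    exact rho_subdivide_lt_rho hG h0 h1 (h.adj 0 hk) hx hr (hmin 1 hk) hb hbq
      (Or.inr ⟨c, hc, hcq, hbc.symm⟩)
  · obtain ⟨m, rfl⟩ := Nat.exists_eq_add_of_le' hm0
    rw [h.toIsChain.rho_subdivide hG h0 h1 hi (j := m) hm, subdivide_comm]
    have hadj := (h.adj m hm).symm
    rcases hm.lt_or_eq with hlt | heq
    · exact rho_subdivide_lt_rho hG h0 h1 hadj hx hr (hmin m (by omega)) (h.adj (m + 1) hlt)
        (h.ne m hlt).symm (Or.inl (hmin (m + 2) hlt))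
    · obtain ⟨b, c, hb, hc, hbq, hcq, hbc⟩ := h.branch_end (v m) (heq ▸ hadj)
      rw [← heq] at hb hc
      exact rho_subdivide_lt_rho hG h0 h1 hadj hx hr (hmin m (by omega)) hb hbq
        (Or.inr ⟨c, hc, hcq, hbc.symm⟩)

end Chain
-- The bound ρ > 2 in the presence of an internal path, and its equality case
section Bound

variable {V : Type*} [Fintype V]

/-- A chain with branching ends, two pendant vertices at either end and nothing else, is a double
snake. -/
theorem isDoubleSnake_of_chain {G : SimpleGraph V} {v : ℕ → V} {k : ℕ} {b c b' c' : V}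
    (hk : 1 ≤ k) (hadj : ∀ i, i < k → G.Adj (v i) (v (i + 1)))
    (hinj : ∀ i j, i ≤ k → j ≤ k → v i = v j → i = j)
    (hb : G.Adj (v 0) b) (hc : G.Adj (v 0) c) (hb' : G.Adj (v k) b') (hc' : G.Adj (v k) c')
    (hbc : b ≠ c) (hbc' : b' ≠ c') (h1 : b ≠ b') (h2 : b ≠ c') (h3 : c ≠ b') (h4 : c ≠ c')
    (hvb : ∀ i, i ≤ k → v i ≠ b) (hvc : ∀ i, i ≤ k → v i ≠ c)
    (hvb' : ∀ i, i ≤ k → v i ≠ b') (hvc' : ∀ i, i ≤ k → v i ≠ c')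
    (hsurj : ∀ z, (∃ i, i ≤ k ∧ z = v i) ∨ z = b ∨ z = c ∨ z = b' ∨ z = c')
    {y : V → ℝ} (hy : PerronPair G 0 2 y) (hyv : ∀ i, i ≤ k → y (v i) = 1)
    (hyb : y b = 1 / 2) (hyc : y c = 1 / 2) (hyb' : y b' = 1 / 2) (hyc' : y c' = 1 / 2) :
    IsDoubleSnake G := by
  -- The labelling of `doubleSnake (k + 5)`: its long path 0, …, k + 2 runs through b, the chain and
  -- b', and the last two labels are the remaining pendant vertices c and c'.
  obtain ⟨F, hF⟩ : ∃ F : ℕ → V, F = fun i => if i = 0 then b else if i ≤ k + 1 then v (i - 1)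
    else if i = k + 2 then b' else if i = k + 3 then c else c' := ⟨_, rfl⟩
  have F0 : F 0 = b := by simp [hF]
  have Fv : ∀ m, m ≤ k → F (m + 1) = v m := fun m hm => by simp [hF, hm]
  have Fb : F (k + 2) = b' := by simp [hF]
  have Fc : F (k + 3) = c := by simp [hF]
  have Fc' : F (k + 4) = c' := by simp [hF]
  have hcl : ∀ i, i < k + 5 → i = 0 ∨ (∃ m, m ≤ k ∧ i = m + 1) ∨ i = k + 2 ∨ i = k + 3 ∨
      i = k + 4 := by
    intro i hi
    by_cases h : 1 ≤ i ∧ i ≤ k + 1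
    · exact Or.inr (Or.inl ⟨i - 1, by omega, by omega⟩)
    · omega
  have Finj : ∀ i j, i < k + 5 → j < k + 5 → F i = F j → i = j := by
    intro i j hi hj h
    have h' := h
    rcases hcl i hi with rfl | ⟨m, hm, rfl⟩ | rfl | rfl | rfl <;>
    rcases hcl j hj with rfl | ⟨m', hm', rfl⟩ | rfl | rfl | rfl <;>
    simp only [F0, Fv _ ‹_›, Fb, Fc, Fc'] at h
    all_goals first
      | rfl
      | exact absurd h ‹_›
      | exact absurd h.symm ‹_›
      | exact absurd h (hvb _ ‹_›)
      | exact absurd h (hvc _ ‹_›)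
      | exact absurd h (hvb' _ ‹_›)
      | exact absurd h (hvc' _ ‹_›)
      | exact absurd h.symm (hvb _ ‹_›)
      | exact absurd h.symm (hvc _ ‹_›)
      | exact absurd h.symm (hvb' _ ‹_›)
      | exact absurd h.symm (hvc' _ ‹_›)
      | rw [hinj _ _ hm hm' ((Fv m hm).symm.trans (h'.trans (Fv m' hm')))]
  have bij : Function.Bijective (fun i : Fin (k + 5) => F i.val) := by
    refine ⟨fun i j h => Fin.ext (Finj _ _ i.2 j.2 h), fun z => ?_⟩
    rcases hsurj z with ⟨m, hm, rfl⟩ | rfl | rfl | rfl | rfl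
    · exact ⟨⟨m + 1, by omega⟩, Fv m hm⟩
    · exact ⟨⟨0, by omega⟩, F0⟩
    · exact ⟨⟨k + 3, by omega⟩, Fc⟩
    · exact ⟨⟨k + 2, by omega⟩, Fb⟩
    · exact ⟨⟨k + 4, by omega⟩, Fc'⟩
  have hrel : ∀ i j, ((i + 1 = j ∧ j + 2 < k + 5) ∨ (i = 1 ∧ j + 2 = k + 5) ∨
      (i + 4 = k + 5 ∧ j + 1 = k + 5)) → G.Adj (F i) (F j) := by
    rintro i j (⟨rfl, h⟩ | ⟨rfl, h⟩ | ⟨h, h'⟩)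
    · rcases Nat.eq_zero_or_pos i with rfl | hi
      · rw [F0, Fv 0 (by omega)]; exact hb.symm
      · obtain ⟨m, rfl⟩ := Nat.exists_eq_add_of_le' hi
        rcases (show m < k ∨ m = k by omega) with hm | rfl
        · rw [Fv m hm.le, Fv (m + 1) hm]; exact hadj m hm
        · rw [Fv m le_rfl, Fb]; exact hb'
    · obtain rfl : j = k + 3 := by omega
      rw [Fv 0 (by omega), Fc]; exact hc
    · obtain rfl : j = k + 4 := by omega
      obtain rfl : i = k + 1 := by omega
      rw [Fv k le_rfl, Fc']; exact hc'
  have hhom : ∀ i j : Fin (k + 5), (doubleSnake (k + 5)).Adj i j → G.Adj (F i.val) (F j.val) := by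
    intro i j h
    rcases (doubleSnake_adj.1 h).2 with h | h
    · exact hrel _ _ h
    · exact (hrel _ _ h).symm
  have hvec : ∀ i : Fin (k + 5), y (F i.val) = snakeVec (k + 5) i := by
    rintro ⟨i, hi⟩
    simp only [snakeVec]
    rcases hcl i hi with rfl | ⟨m, hm, rfl⟩ | rfl | rfl | rfl
    · rw [F0, hyb, if_neg (by omega)]
    · rw [Fv m hm, hyv m hm, if_pos (by omega)]
    · rw [Fb, hyb', if_neg (by omega)]
    · rw [Fc, hyc, if_neg (by omega)]
    · rw [Fc', hyc', if_neg (by omega)]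
  let e : Fin (k + 5) ≃ V := Equiv.ofBijective _ bij
  refine ⟨k + 5, by omega, ⟨SimpleGraph.Iso.symm ⟨e, ?_⟩⟩⟩
  intro i j
  -- Only one direction was checked by hand; the matching eigenvectors exclude any further edges of
  -- G.
  exact ⟨adj_of_perronPair le_rfl one_pos (perronPair_doubleSnake (by omega)) hy e hhom hvec,
    hhom i j⟩

/-- A graph with a chain with branching ends has Perron root greater than two, unless it is a
double snake and `α = 0`. -/
theorem IsBranchChain.two_lt {G : SimpleGraph V} {v : ℕ → V} {k : ℕ}
    (h : IsBranchChain G v k) (hG : G.Connected) {α : ℝ} (h0 : 0 ≤ α) (h1 : α < 1) {r : ℝ}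
    {x : V → ℝ} (hx : PerronPair G α r x) : 2 < r ∨ (IsDoubleSnake G ∧ α = 0) := by
  classical
  by_contra! hcon
  obtain ⟨hr, hcon⟩ := hcon
  have hk := h.one_le
  obtain ⟨P, hP⟩ : ∃ P : V → Prop, P = fun w => ∃ i, i ≤ k ∧ w = v i := ⟨_, rfl⟩
  have hPv : ∀ i, i ≤ k → P (v i) := fun i hi => by rw [hP]; exact ⟨i, hi, rfl⟩
  have h2α : 0 < 2 - α := by linarith
  -- This b solves α b + (1 - α) = 2 b, the equation at a vertex off the chain with a single
  -- neighbour, of value 1. Then α + (1 - α) b = 1 / (2 - α), which is at least 1/2 with equality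
  -- only for α = 0.
  obtain ⟨b, hb⟩ : ∃ b, b = (1 - α) / (2 - α) := ⟨_, rfl⟩
  have hb0 : 0 < b := by rw [hb]; exact div_pos (by linarith) h2α
  have hb1 : b ≤ 1 := by rw [hb, div_le_one h2α]; linarith
  have hbe : b * (2 - α) = 1 - α := by rw [hb, div_mul_cancel₀ _ h2α.ne']
  have hbr : (α + (1 - α) * b) * (2 - α) = 1 := by
    rw [add_mul, mul_assoc, hbe]; ring
  let y : V → ℝ := fun w => if P w then 1 else if ∃ p, P p ∧ G.Adj w p then b else 0
  have y1 : ∀ w, P w → y w = 1 := fun w hw => if_pos hw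
  have yb : ∀ w p, ¬ P w → P p → G.Adj w p → y w = b := fun w p hw hp hwp => by
    simp only [y]; rw [if_neg hw, if_pos ⟨p, hp, hwp⟩]
  have hy0 : ∀ w, 0 ≤ y w := by
    intro w; simp only [y]; split_ifs <;> first | exact zero_le_one | exact hb0.le | exact le_rfl
  have hyb : ∀ w p, P p → G.Adj w p → b ≤ y w := by
    intro w p hp hwp
    by_cases hw : P w
    · rw [y1 w hw]; exact hb1
    · rw [yb w p hw hp hwp]
  have hspine : ∀ p, P p → (∃ a c, P a ∧ P c ∧ a ≠ c ∧ G.Adj p a ∧ G.Adj p c ∧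
      (∀ z, G.Adj p z → P z)) ∨
      ((p = v 0 ∨ p = v k) ∧ ∃ a, P a ∧ G.Adj p a ∧ HasBranch G p) := by
    intro p hp
    rw [hP] at hp
    obtain ⟨i, hi, rfl⟩ := hp
    rcases Nat.eq_zero_or_pos i with rfl | hi0
    · exact Or.inr ⟨Or.inl rfl, v 1, hPv 1 hk, h.adj 0 hk, h.branch_start⟩
    · obtain ⟨m, rfl⟩ := Nat.exists_eq_add_of_le' hi0
      rcases hi.lt_or_eq with hlt | heq
      · refine Or.inl ⟨v m, v (m + 2), hPv _ (by omega), hPv _ hlt, h.ne m hlt,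
          (h.adj m (by omega)).symm, h.adj (m + 1) hlt, fun z hz => ?_⟩
        rcases h.nbr m hlt z hz with rfl | rfl
        · exact hPv _ (by omega)
        · exact hPv _ hlt
      · refine Or.inr ⟨Or.inr (by rw [heq]), v m, hPv _ (by omega), (h.adj m (by omega)).symm, ?_⟩
        rw [heq]; exact h.branch_end
  have hbranch : ∀ p a, P p → P a → G.Adj p a → HasBranch G p →
      1 + 2 * (α + (1 - α) * b) ≤ alphaOp G α y p := by
    intro p a hp ha hpa hB
    obtain ⟨c, d, hc, hd, hca, hda, hcd⟩ := hB a hpa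
    refine le_trans ?_ (sum_le_alphaOp h0 h1 hy0 {a, c, d} ?_)
    · rw [Finset.sum_insert (by simp [hca.symm, hda.symm]), Finset.sum_pair hcd, y1 p hp, y1 a ha]
      have e1 := mul_le_mul_of_nonneg_left (hyb c p hp hc.symm) (sub_nonneg.2 h1.le)
      have e2 := mul_le_mul_of_nonneg_left (hyb d p hp hd.symm) (sub_nonneg.2 h1.le)
      linarith
    · simp [hpa, hc, hd]
  have hbr1 : 1 ≤ 2 * (α + (1 - α) * b) := by
    by_contra! hlt
    have := mul_lt_mul_of_pos_right hlt h2α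
    linarith
  have hsub : ∀ i, 2 * y i ≤ alphaOp G α y i := by
    intro w
    by_cases hw : P w
    · rw [y1 w hw]
      rcases hspine w hw with ⟨a, c, ha, hc, hac, hwa, hwc, -⟩ | ⟨-, a, ha, hwa, hB⟩
      · refine le_trans (le_of_eq ?_) (sum_le_alphaOp h0 h1 hy0 {a, c} (by simp [hwa, hwc]))
        rw [Finset.sum_pair hac, y1 w hw, y1 a ha, y1 c hc]; ring
      · have := hbranch w a hw ha hwa hB
        linarith
    · by_cases hp : ∃ p, P p ∧ G.Adj w p
      · obtain ⟨p, hp, hwp⟩ := hp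
        refine le_trans (le_of_eq ?_) (sum_le_alphaOp h0 h1 hy0 {p} (by simp [hwp]))
        rw [Finset.sum_singleton, yb w p hw hp hwp, y1 p hp]
        linarith
      · have : y w = 0 := by simp only [y]; rw [if_neg hw, if_neg hp]
        rw [this, mul_zero]
        exact alphaOp_nonneg h0 h1 hy0 w
  -- A strict inequality anywhere would give 2 < r, so all the estimates are equalities and y is an
  -- eigenvector.
  have heig : ∀ i, alphaOp G α y i = 2 * y i := by
    intro i
    by_contra hne
    exact not_lt.2 hr (hx.lt_of_sub hy0 hsub ⟨i, lt_of_le_of_ne (hsub i) (Ne.symm hne)⟩)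
  have hα : α = 0 := by
    have e1 := hbranch (v 0) (v 1) (hPv 0 (by omega)) (hPv 1 hk) (h.adj 0 hk) h.branch_start
    rw [heig, y1 _ (hPv 0 (by omega))] at e1
    have : 2 * (α + (1 - α) * b) = 1 := by linarith
    have e2 : 2 * (α + (1 - α) * b) * (2 - α) = 2 - α := by rw [this, one_mul]
    linarith
  refine hcon ?_ hα
  subst hα
  have hbh : b = 1 / 2 := by rw [hb]; norm_num
  have hypos : ∀ i, 0 < y i := pos_of_nonneg_eigenvector hG h0 h1 hy0
    (Function.ne_iff.2 ⟨v 0, by rw [y1 _ (hPv 0 (by omega))]; simp⟩) heig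
  have hpp : PerronPair G 0 2 y := ⟨hypos, heig⟩
  have hsum : ∀ i (s : Finset V), (∀ j ∈ s, G.Adj i j) → ∑ j ∈ s, y j ≤ 2 * y i := by
    intro i s hs
    rw [← heig]
    refine le_trans (le_of_eq ?_) (sum_le_alphaOp h0 h1 hy0 s hs)
    exact Finset.sum_congr rfl fun j _ => by ring
  -- Such a vertex has value 1/2, so its neighbours sum to 1, which its chain neighbour alone
  -- supplies; positivity rules out others.
  have hout : ∀ w, ¬ P w → ∃ p, P p ∧ G.Adj w p ∧ y w = 1 / 2 ∧ ∀ z, G.Adj w z → z = p := by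
    intro w hw
    have : ∃ p, P p ∧ G.Adj w p := by
      by_contra hp
      have := hypos w
      simp only [y] at this
      rw [if_neg hw, if_neg hp] at this
      exact lt_irrefl _ this
    obtain ⟨p, hp, hwp⟩ := this
    have hyw : y w = 1 / 2 := by rw [yb w p hw hp hwp, hbh]
    refine ⟨p, hp, hwp, hyw, fun z hz => ?_⟩
    by_contra hzp
    have := hsum w {p, z} (by simp [hwp, hz])
    rw [Finset.sum_pair (Ne.symm hzp), y1 p hp, hyw] at this
    have := hypos z
    linarith
  -- The neighbours of an end sum to 2 = 1 + 1/2 + 1/2, so the two branches lie off the chain and no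
  -- fourth neighbour exists.
  have hend : ∀ p a, P p → P a → G.Adj p a → HasBranch G p → ∃ c d, ¬ P c ∧ ¬ P d ∧ c ≠ d ∧
      G.Adj p c ∧ G.Adj p d ∧ ∀ z, G.Adj p z → z = a ∨ z = c ∨ z = d := by
    intro p a hp ha hpa hB
    obtain ⟨c, d, hc, hd, hca, hda, hcd⟩ := hB a hpa
    have ec := hyb c p hp hc.symm
    have ed := hyb d p hp hd.symm
    rw [hbh] at ec ed
    have e3 := hsum p {a, c, d} (by simp [hpa, hc, hd])
    rw [Finset.sum_insert (by simp [hca.symm, hda.symm]), Finset.sum_pair hcd, y1 p hp,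
      y1 a ha] at e3
    refine ⟨c, d, fun hPc => ?_, fun hPd => ?_, hcd, hc, hd, fun z hz => ?_⟩
    · rw [y1 c hPc] at e3; linarith
    · rw [y1 d hPd] at e3; linarith
    · by_contra! hn
      have e4 := hsum p {z, a, c, d} (by simp [hz, hpa, hc, hd])
      rw [Finset.sum_insert (by simp [hn]), Finset.sum_insert (by simp [hca.symm, hda.symm]),
        Finset.sum_pair hcd, y1 p hp, y1 a ha] at e4
      have := hypos z
      linarith
  obtain ⟨m, rfl⟩ := Nat.exists_eq_add_of_le' hk
  have hP0 := hPv 0 (by omega)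
  have hPk := hPv (m + 1) le_rfl
  obtain ⟨c, d, hPc, hPd, hcd, h0c, h0d, hN0⟩ :=
    hend (v 0) (v 1) hP0 (hPv 1 hk) (h.adj 0 hk) h.branch_start
  obtain ⟨c', d', hPc', hPd', hcd', hkc', hkd', hNk⟩ :=
    hend (v (m + 1)) (v m) hPk (hPv m (by omega)) (h.adj m (by omega)).symm h.branch_end
  -- A closed chain would make v m a chain neighbour of v 0. The only one is v 1, which forces m ≤
  -- 1: a loop or an immediate backtracking.
  have h0k : v 0 ≠ v (m + 1) := by
    intro he
    have hadj : G.Adj (v 0) (v m) := he ▸ (h.adj m (by omega)).symm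
    rcases hN0 _ hadj with e | e | e
    · rcases Nat.eq_zero_or_pos m with rfl | hm
      · exact (h.adj 0 hk).ne he
      · have := h.inj m 1 hm (by omega) le_rfl hk e
        subst this
        exact h.ne 0 (by omega) he
    · exact hPc (e ▸ hPv m (by omega))
    · exact hPd (e ▸ hPv m (by omega))
  have h0i : ∀ i, 1 ≤ i → i ≤ m + 1 → v 0 ≠ v i := by
    intro i hi hik he
    rcases hik.lt_or_eq with hlt | rfl
    · obtain ⟨i, rfl⟩ := Nat.exists_eq_add_of_le' hi
      rcases h.nbr i hlt c (he ▸ h0c) with e | e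
      · exact hPc (e ▸ hPv i (by omega))
      · exact hPc (e ▸ hPv (i + 2) (by omega))
    · exact h0k he
  have hinj : ∀ i j, i ≤ m + 1 → j ≤ m + 1 → v i = v j → i = j := by
    intro i j hi hj he
    rcases Nat.eq_zero_or_pos i with rfl | hi0 <;> rcases Nat.eq_zero_or_pos j with rfl | hj0
    · rfl
    · exact absurd he (h0i j hj0 hj)
    · exact absurd he.symm (h0i i hi0 hi)
    · exact h.inj i j hi0 hi hj0 hj he
  have hdis : ∀ w w', ¬ P w → G.Adj (v 0) w → G.Adj (v (m + 1)) w' → w ≠ w' := by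
    rintro w w' hw h1 h2 rfl
    obtain ⟨p, -, -, -, hp⟩ := hout w hw
    exact h0k ((hp _ h1.symm).trans (hp _ h2.symm).symm)
  have hvne : ∀ w, ¬ P w → ∀ i, i ≤ m + 1 → v i ≠ w := fun w hw i hi he => hw (he ▸ hPv i hi)
  have hhalf : ∀ w, ¬ P w → y w = 1 / 2 := fun w hw => by
    obtain ⟨p, -, -, h, -⟩ := hout w hw
    exact h
  refine isDoubleSnake_of_chain hk h.adj hinj h0c h0d hkc' hkd' hcd hcd' (hdis _ _ hPc h0c hkc')
    (hdis _ _ hPc h0c hkd') (hdis _ _ hPd h0d hkc') (hdis _ _ hPd h0d hkd') (hvne c hPc)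
    (hvne d hPd) (hvne c' hPc') (hvne d' hPd') (fun z => ?_) hpp (fun i hi => y1 _ (hPv i hi))
    (hhalf c hPc) (hhalf d hPd) (hhalf c' hPc') (hhalf d' hPd')
  by_cases hz : P z
  · left; rwa [hP] at hz
  · right
    obtain ⟨p, hp, hzp, -, -⟩ := hout z hz
    rcases hspine p hp with ⟨a, c, -, -, -, -, -, hall⟩ | ⟨rfl | rfl, -⟩
    · exact absurd (hall z hzp.symm) hz
    · rcases hN0 z hzp.symm with rfl | rfl | rfl
      · exact absurd (hPv 1 hk) hz
      · simp
      · simp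
    · rcases hNk z hzp.symm with rfl | rfl | rfl
      · exact absurd (hPv m (by omega)) hz
      · simp
      · simp

/-- Subdividing an edge of an internal path decreases the spectral radius, except for the double
snakes at `α = 0`. -/
theorem rho_subdivide_lt_of_onInternalPath [DecidableEq V] {G : SimpleGraph V} (hG : G.Connected)
    {α : ℝ} (h0 : 0 ≤ α) (h1 : α < 1) {u v : V} (hn : ¬ (IsDoubleSnake G ∧ α = 0))
    (h : OnInternalPath G u v) : rho (subdivide G u v) α < rho G α := by
  obtain ⟨a, b, w, hw, huv⟩ := h
  obtain ⟨i, hi, he⟩ := exists_getVert_of_mem_edges huv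
  obtain ⟨r, x, hx⟩ := exists_perronPair hG h0 h1
  rw [subdivide_congr he]
  exact hw.isBranchChain.rho_subdivide_lt hG h0 h1 hx
    ((hw.isBranchChain.two_lt hG h0 h1 hx).resolve_right hn) hi

end Bound
-- Edges on no internal path lead to a pendant vertex
section Pendant

variable {V : Type*}

theorem getVert_concat_of_le {G : SimpleGraph V} {a b c : V} {p : G.Walk a b} (h : G.Adj b c) {i : ℕ} (hi : i ≤ p.length) :
    (p.concat h).getVert i = p.getVert i := by
  rw [SimpleGraph.Walk.concat_eq_append, SimpleGraph.Walk.getVert_append]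
  split_ifs with hlt
  · rfl
  · obtain rfl : i = p.length := by omega
    simp

variable [Fintype V]

open scoped Classical in
/-- A path through the edge `e` all of whose interior vertices have degree two. -/
structure IsThread (G : SimpleGraph V) (e : Sym2 V) {a b : V} (p : G.Walk a b) : Prop where
  isPath : p.IsPath
  degree_interior : ∀ i, 0 < i → i < p.length → G.degree (p.getVert i) = 2
  mem_edges : e ∈ p.edges

variable {G : SimpleGraph V} {e : Sym2 V} {a b : V} {p : G.Walk a b}

theorem IsThread.reverse (h : IsThread G e p) : IsThread G e p.reverse := by
  refine ⟨h.isPath.reverse, fun i hi hi' => ?_, by simpa using h.mem_edges⟩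
  rw [SimpleGraph.Walk.length_reverse] at hi'
  rw [SimpleGraph.Walk.getVert_reverse]
  exact h.degree_interior _ (by omega) (by omega)

theorem IsThread.one_le_length (h : IsThread G e p) : 1 ≤ p.length := by
  have := List.length_pos_of_mem h.mem_edges
  rwa [SimpleGraph.Walk.length_edges] at this

theorem IsThread.inj (h : IsThread G e p) {i j : ℕ} (hi : i ≤ p.length) (hj : j ≤ p.length)
    (hij : p.getVert i = p.getVert j) : i = j :=
  h.isPath.getVert_injOn hi hj hij

theorem IsThread.isChain (h : IsThread G e p) : IsChain G p.getVert p.length := by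
  have hne : ∀ i, i + 1 < p.length → p.getVert i ≠ p.getVert (i + 2) := fun i hi he => by
    have := h.inj (by omega) (by omega) he
    omega
  refine ⟨fun i hi => p.adj_getVert_succ hi, hne, fun i hi => ?_⟩
  exact eq_or_eq_of_degree_eq_two (h.degree_interior _ (by omega) hi)
    (p.adj_getVert_succ (by omega)).symm (p.adj_getVert_succ hi) (hne i hi)

/-- A connected graph with a closed chain of vertices of degree two is a cycle. -/
theorem isCycleGraph_of_closed_chain {v : ℕ → V} {k : ℕ} (hG : G.Connected) (hk : 2 ≤ k)
    (hadj : ∀ i, i < k → G.Adj (v i) (v (i + 1))) (hclose : G.Adj (v k) (v 0))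
    (hinj : ∀ i j, i ≤ k → j ≤ k → v i = v j → i = j)
    (hdeg : ∀ i, i ≤ k → open scoped Classical in G.degree (v i) = 2) : IsCycleGraph G := by
  classical
  have hcl : ∀ i, i ≤ k → ∀ z, G.Adj (v i) z → ∃ j, j ≤ k ∧ z = v j := by
    intro i hi z hz
    rcases Nat.eq_zero_or_pos i with rfl | hi0
    · rcases eq_or_eq_of_degree_eq_two (hdeg 0 hi) (hadj 0 (by omega)) hclose.symm
        (fun h => by have := hinj _ _ (by omega) le_rfl h; omega) z hz with rfl | rfl
      exacts [⟨_, by omega, rfl⟩, ⟨_, le_rfl, rfl⟩]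
    · obtain ⟨m, rfl⟩ := Nat.exists_eq_add_of_le' hi0
      rcases hi.lt_or_eq with hlt | rfl
      · rcases eq_or_eq_of_degree_eq_two (hdeg _ hi) (hadj m (by omega)).symm (hadj (m + 1) hlt)
          (fun h => by have := hinj _ _ (by omega) (by omega) h; omega) z hz with rfl | rfl
        exacts [⟨_, by omega, rfl⟩, ⟨_, hlt, rfl⟩]
      · rcases eq_or_eq_of_degree_eq_two (hdeg _ hi) (hadj m (by omega)).symm hclose
          (fun h => by have := hinj _ _ (by omega) (by omega) h; omega) z hz with rfl | rfl
        exacts [⟨_, by omega, rfl⟩, ⟨_, by omega, rfl⟩]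
  have hsurj : ∀ z, ∃ j, j ≤ k ∧ z = v j := by
    intro z
    obtain ⟨w⟩ := hG.preconnected z (v 0)
    generalize hv0 : v 0 = t at w
    induction w with
    | nil => exact ⟨0, by omega, hv0.symm⟩
    | cons h _ ih =>
      obtain ⟨j, hj, rfl⟩ := ih hv0
      exact hcl j hj _ h.symm
  have hpp : PerronPair G 0 2 (fun _ => 1) := by
    refine ⟨fun _ => one_pos, fun z => ?_⟩
    obtain ⟨j, hj, rfl⟩ := hsurj z
    rw [alphaOp_eq', Finset.sum_const, SimpleGraph.card_neighborFinset_eq_degree, hdeg j hj]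
    norm_num
  let f : Fin (k + 1) ≃ V := Equiv.ofBijective (fun i => v i.val)
    ⟨fun i j h => Fin.ext (hinj _ _ (by omega) (by omega) h), fun z => by
      obtain ⟨j, hj, rfl⟩ := hsurj z
      exact ⟨⟨j, by omega⟩, rfl⟩⟩
  have hsub : ∀ i j : Fin (k + 1), (j - i).val = 1 → G.Adj (f i) (f j) := by
    rintro ⟨i, hi⟩ ⟨j, hj⟩ h
    change G.Adj (v i) (v j)
    rw [Fin.sub_def] at h
    simp only at h
    rcases le_or_gt i j with hle | hlt
    · rw [show k + 1 - i + j = (j - i) + (k + 1) by omega, Nat.add_mod_right,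
        Nat.mod_eq_of_lt (by omega)] at h
      obtain rfl : j = i + 1 := by omega
      exact hadj i (by omega)
    · rw [Nat.mod_eq_of_lt (by omega)] at h
      obtain rfl : j = 0 := by omega
      obtain rfl : i = k := by omega
      exact hclose
  have hhom : ∀ i j : Fin (k + 1), (SimpleGraph.cycleGraph (k + 1)).Adj i j → G.Adj (f i) (f j) := by
    intro i j h
    rcases SimpleGraph.cycleGraph_adj'.1 h with h | h
    · exact (hsub j i h).symm
    · exact hsub i j h
  refine ⟨k + 1, by omega, ⟨SimpleGraph.Iso.symm ⟨f, ?_⟩⟩⟩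
  intro i j
  exact ⟨adj_of_perronPair le_rfl one_pos (perronPair_cycleGraph (by omega) 0) hpp f hhom
    (fun _ => rfl), hhom i j⟩

open scoped Classical in
/-- A thread whose last vertex has degree two but cannot be prolonged closes up to a cycle, or to
an internal path. -/
theorem IsThread.closed {u v : V} {p : G.Walk a b} (h : IsThread G s(u, v) p) (hG : G.Connected)
    (hb : G.degree b = 2) (hext : ∀ z, G.Adj b z → z ∈ p.support) :
    IsCycleGraph G ∨ OnInternalPath G u v := by
  have hk := h.one_le_length
  obtain ⟨m, hm⟩ := Nat.exists_eq_add_of_le' hk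
  have hvk : p.getVert (m + 1) = b := by rw [← hm]; exact p.getVert_length
  have hv0 : p.getVert 0 = a := p.getVert_zero
  have hpred : G.Adj b (p.getVert m) := by
    have := p.adj_getVert_succ (i := m) (by omega)
    rw [hvk] at this
    exact this.symm
  obtain ⟨y, hy, hyne⟩ : ∃ y, G.Adj b y ∧ y ≠ p.getVert m := by
    have h2 : 1 < (G.neighborFinset b).card := by
      rw [SimpleGraph.card_neighborFinset_eq_degree, hb]; exact one_lt_two
    obtain ⟨y, hy, hne⟩ := Finset.exists_mem_ne h2 (p.getVert m)
    exact ⟨y, by rwa [SimpleGraph.mem_neighborFinset] at hy, hne⟩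
  obtain ⟨i, rfl, hi⟩ := SimpleGraph.Walk.mem_support_iff_exists_getVert.1 (hext y hy)
  have hik : i ≠ m + 1 := by rintro rfl; rw [hvk] at hy; exact hy.ne rfl
  have him : i ≠ m := by rintro rfl; exact hyne rfl
  -- Interior vertices of the path have only their two path neighbours, so the second neighbour of b
  -- on the path is its starting vertex.
  obtain rfl : i = 0 := by
    by_contra hi0
    obtain ⟨j, rfl⟩ := Nat.exists_eq_add_of_le' (Nat.pos_of_ne_zero hi0)
    rcases h.isChain.nbr j (by omega) b hy.symm with e | e
    · have := h.inj (i := m + 1) (j := j) (by omega) (by omega) (hvk.trans e)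
      omega
    · have := h.inj (i := m + 1) (j := j + 2) (by omega) (by omega) (hvk.trans e)
      omega
  have h01 : G.Adj (p.getVert 0) (p.getVert 1) := p.adj_getVert_succ hk
  have hb1 : p.getVert 1 ≠ b := by
    intro e
    have := h.inj (i := 1) (j := m + 1) (by omega) (by omega) (e.trans hvk.symm)
    omega
  have hdeg : 2 ≤ G.degree (p.getVert 0) := by
    rw [← SimpleGraph.card_neighborFinset_eq_degree]
    refine Finset.one_lt_card.2 ⟨p.getVert 1, ?_, b, ?_, hb1⟩ <;>
      rw [SimpleGraph.mem_neighborFinset]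
    exacts [h01, hy.symm]
  -- The path closes up at its starting vertex: degree above two there gives an internal path with
  -- equal ends, degree two gives a cycle.
  rcases hdeg.lt_or_eq with hlt | heq
  · right
    rw [hv0] at hy hlt
    have hl : (p.concat hy).length = p.length + 1 := SimpleGraph.Walk.length_concat _ _
    refine ⟨a, a, p.concat hy, ⟨by omega, ?_, ?_, hlt, hlt, ?_⟩, ?_⟩
    · rw [SimpleGraph.Walk.isTrail_def, SimpleGraph.Walk.edges_concat, List.concat_eq_append,
        List.nodup_append]
      refine ⟨h.isPath.isTrail.edges_nodup, List.nodup_singleton _, ?_⟩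
      intro e1 he1 e2 he2 he
      rw [List.mem_singleton] at he2
      rw [he, he2] at he1
      obtain ⟨i, hi, he⟩ := exists_getVert_of_mem_edges he1
      rcases Sym2.eq_iff.1 he with ⟨-, h2⟩ | ⟨h1, h2⟩
      · have := h.inj (i := 0) (j := i + 1) (by omega) (by omega) (hv0.trans h2)
        omega
      · have e1 := h.inj (i := 0) (j := i) (by omega) (by omega) (hv0.trans h2)
        have e2 := h.inj (i := m + 1) (j := i + 1) (by omega) (by omega) (hvk.trans h1)
        omega
    · have hs : p.support = a :: p.support.tail := p.cons_tail_support.symm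
      have hn := h.isPath.support_nodup
      rw [hs, List.nodup_cons] at hn
      rw [SimpleGraph.Walk.support_concat, hs, List.cons_append,
        List.tail_cons, List.nodup_append]
      refine ⟨hn.2, List.nodup_singleton _, ?_⟩
      intro x hx z hz he
      rw [List.mem_singleton] at hz
      rw [he, hz] at hx
      exact hn.1 hx
    · intro i hi hi'
      rw [getVert_concat_of_le hy (by omega)]
      rcases (show i < p.length ∨ i = m + 1 by omega) with hi' | rfl
      · exact h.degree_interior i hi hi'
      · rw [hvk]; exact hb
    · rw [SimpleGraph.Walk.edges_concat, List.concat_eq_append, List.mem_append]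
      exact Or.inl h.mem_edges
  · left
    refine isCycleGraph_of_closed_chain (v := p.getVert) (k := m + 1) hG (by omega)
      (fun i hi => p.adj_getVert_succ (by omega)) (by rw [hvk]; exact hy)
      (fun i j hi hj => h.inj (by omega) (by omega)) fun i hi => ?_
    rcases Nat.eq_zero_or_pos i with rfl | hi0
    · exact heq.symm
    · rcases hi.lt_or_eq with hlt | rfl
      · exact h.degree_interior i hi0 (by omega)
      · rw [hvk]; exact hb

open scoped Classical in
theorem IsThread.exists_longer {u v : V} {p : G.Walk a b} (h : IsThread G s(u, v) p)
    (hG : G.Connected) (hc : ¬ IsCycleGraph G) (hi : ¬ OnInternalPath G u v)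
    (hb : G.degree b = 2) :
    ∃ (c : V) (q : G.Walk a c), IsThread G s(u, v) q ∧ q.length = p.length + 1 := by
  by_contra! hcon
  refine (h.closed hG hb fun z hz => ?_).elim hc hi
  by_contra hzs
  have hl : (p.concat hz).length = p.length + 1 := SimpleGraph.Walk.length_concat _ _
  refine hcon z (p.concat hz) ⟨h.isPath.concat hzs hz, fun i hi hi' => ?_, ?_⟩ hl
  · rw [getVert_concat_of_le hz (by omega)]
    rcases (show i < p.length ∨ i = p.length by omega) with hi' | rfl
    · exact h.degree_interior i hi hi'
    · rw [SimpleGraph.Walk.getVert_length]; exact hb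
  · rw [SimpleGraph.Walk.edges_concat, List.concat_eq_append, List.mem_append]
    exact Or.inl h.mem_edges

open scoped Classical in
/-- An edge on no internal path of a graph that is not a cycle lies on a path that ends in a
pendant vertex and has interior vertices of degree two. -/
theorem exists_pendant_thread {u v : V} (hG : G.Connected) (huv : G.Adj u v)
    (hc : ¬ IsCycleGraph G) (hi : ¬ OnInternalPath G u v) :
    ∃ (a b : V) (p : G.Walk a b), IsThread G s(u, v) p ∧ G.degree b = 1 := by
  by_contra! hcon
  -- If no thread ended in a pendant vertex, every thread could be prolonged at an end of degree
  -- two; both ends of degree at least three would make it an internal path. But a path has fewer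
  -- edges than the graph has vertices.
  have key : ∀ n : ℕ, ∃ (a b : V) (p : G.Walk a b), IsThread G s(u, v) p ∧ p.length = n + 1 := by
    intro n
    induction n with
    | zero =>
      refine ⟨u, v, huv.toWalk, ⟨?_, fun i h h' => ?_, by simp⟩, by simp⟩
      · exact SimpleGraph.Walk.IsPath.of_adj huv
      · simp at h'; omega
    | succ n ih =>
      obtain ⟨a, b, p, hp, hl⟩ := ih
      have hpos : ∀ {a b : V} {p : G.Walk a b}, IsThread G s(u, v) p → 0 < G.degree b := by
        intro a b p hp
        have hk := hp.one_le_length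
        rw [SimpleGraph.degree_pos_iff_exists_adj]
        refine ⟨p.getVert (p.length - 1), ?_⟩
        have := p.adj_getVert_succ (i := p.length - 1) (by omega)
        rw [show p.length - 1 + 1 = p.length by omega, p.getVert_length] at this
        exact this.symm
      by_cases hb : G.degree b = 2
      · obtain ⟨c, q, hq, hql⟩ := hp.exists_longer hG hc hi hb
        exact ⟨a, c, q, hq, by omega⟩
      by_cases ha : G.degree a = 2
      · obtain ⟨c, q, hq, hql⟩ := hp.reverse.exists_longer hG hc hi ha
        exact ⟨b, c, q, hq, by rw [SimpleGraph.Walk.length_reverse] at hql; omega⟩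
      have hb1 := hcon a b p hp
      have ha1 := hcon b a p.reverse hp.reverse
      have hb0 := hpos hp
      have ha0 := hpos hp.reverse
      exact absurd ⟨a, b, p, ⟨by omega, hp.isPath.isTrail,
        hp.isPath.support_nodup.sublist (List.tail_sublist _), by omega, by omega,
        hp.degree_interior⟩, hp.mem_edges⟩ hi
  obtain ⟨a, b, p, hp, hl⟩ := key (Fintype.card V)
  have := hp.isPath.length_lt
  omega

/-- Subdividing an edge on no internal path of a graph that is not a cycle increases the spectral
radius. -/
theorem rho_lt_rho_subdivide_of_not_onInternalPath [DecidableEq V] {u v : V} (hG : G.Connected)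
    {α : ℝ} (h0 : 0 ≤ α) (h1 : α < 1) (huv : G.Adj u v) (hc : ¬ IsCycleGraph G)
    (hi : ¬ OnInternalPath G u v) : rho G α < rho (subdivide G u v) α := by
  classical
  obtain ⟨a, b, p, hp, hb⟩ := exists_pendant_thread hG huv hc hi
  obtain ⟨i, hi, he⟩ := exists_getVert_of_mem_edges hp.mem_edges
  obtain ⟨m, hm⟩ := Nat.exists_eq_add_of_le' hp.one_le_length
  have hadj := p.adj_getVert_succ (i := m) (by omega)
  rw [subdivide_congr he, hp.isChain.rho_subdivide hG h0 h1 hi (j := m) (by omega)]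
  have hvb : p.getVert (m + 1) = b := by rw [← hm]; exact p.getVert_length
  refine rho_lt_rho_subdivide_of_pendant hG h0 h1 hadj fun z hz => ?_
  rw [hvb] at hadj hz
  rw [← SimpleGraph.card_neighborFinset_eq_degree] at hb
  exact Finset.card_le_one.1 hb.le _ (by rwa [SimpleGraph.mem_neighborFinset]) _
    (by rw [SimpleGraph.mem_neighborFinset]; exact hadj.symm)

end Pendant
end AlphaInternal

theorem mainTheorem6 (α : ℝ) (hα0 : 0 ≤ α) (hα1 : α < 1) :
    ((∀ n : ℕ, 3 ≤ n → AlphaInternal.rho (SimpleGraph.cycleGraph n) α = 2) ∧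
      (∀ n : ℕ, 6 ≤ n → AlphaInternal.rho (AlphaInternal.doubleSnake n) 0 = 2)) ∧
    (∀ (V : Type*) [Fintype V] [DecidableEq V] (G : SimpleGraph V) (u v : V),
      G.Connected → G.Adj u v →
        (¬ AlphaInternal.IsCycleGraph G → ¬ AlphaInternal.OnInternalPath G u v →
          AlphaInternal.rho G α < AlphaInternal.rho (AlphaInternal.subdivide G u v) α) ∧
        (¬ (AlphaInternal.IsDoubleSnake G ∧ α = 0) → AlphaInternal.OnInternalPath G u v →
          AlphaInternal.rho (AlphaInternal.subdivide G u v) α < AlphaInternal.rho G α)) := by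
  refine ⟨⟨fun n hn => AlphaInternal.rho_cycleGraph hn hα0 hα1,
    fun n hn => AlphaInternal.rho_doubleSnake hn⟩, ?_⟩
  intro V _ _ G u v hG huv
  exact ⟨AlphaInternal.rho_lt_rho_subdivide_of_not_onInternalPath hG hα0 hα1 huv,
    AlphaInternal.rho_subdivide_lt_of_onInternalPath hG hα0 hα1⟩
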